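/- **Setting.** Fix an integer $L\ge 2$ and reals $0<\lambda<1$, $\sigma^2,P_{\mathsf p},P_{\max},\theta_{\mathsf p},\theta_{\mathsf s}>0$; put $\gamma_{\mathsf p}=P_{\mathsf p}/\sigma^2$, $\gamma_{\max}=P_{\max}/\sigma^2$. Let $h_{\mathsf p}\sim\mathcal{CN}(0,1)$, let $\mathbf h_{\mathsf x}\in\mathbb C^L$ have i.i.d. $\mathcal{CN}(0,\lambda)$ entries and $\mathbf h_{\mathsf s}\in\mathbb C^L$ i.i.d. $\mathcal{CN}(0,1)$ entries, all independent. Put $g_{\mathsf p}=|h_{\mathsf p}|^2$, $g_{\mathsf x}=\|\mathbf h_{\mathsf x}\|^2/\lambda$, $g_{\mathsf s}=\|\mathbf h_{\mathsf s}\|^2$, $\mathbf s_{\mathsf x}=\mathbf h_{\mathsf x}/\|\mathbf h_{\mathsf x}\|$, $\mathbf s_{\mathsf s}=\mathbf h_{\mathsf s}/\|\mathbf h_{\mathsf s}\|$. *CDI quantization ($B$ bits).* $\hat{\mathbf s}_{\mathsf x}$ is a unit vector that is a measurable function of $\mathbf s_{\mathsf x}$ and possibly of a random seed independent of all channels, such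 that $\epsilon=1-|\hat{\mathbf s}_{\mathsf x}^\dagger\mathbf s_{\mathsf x}|^2$ satisfies $\Pr(\epsilon\le\tau)=2^B\tau^{L-1}$ for $0\le\tau\le 2^{-B/(L-1)}$. Write $\mathbf s_{\mathsf s}=a\hat{\mathbf s}_{\mathsf x}+b\hat{\mathbf s}_\perp$ with $\hat{\mathbf s}_\perp$ a unit vector orthogonal to $\hat{\mathbf s}_{\mathsf x}$, and put $\delta=|\mathbf s_{\mathsf x}^\dagger\hat{\mathbf s}_\perp|^2$. *IPC signals.* Let $\omega=\sigma^2(\gamma_{\mathsf p}g_{\mathsf p}/\theta_{\mathsf p}-1)$. If $\omega\ge0$ put $\eta=\omega/(\lambda g_{\mathsf x}\epsilon)$ (no feedforward) and $\acute\eta=\omega/(\lambda g_{\mathsf x}\delta)$ (feedforward); if $\omega<0$ put $\eta=\acute\eta=P_{\max}$. *IPC quantization ($A$ bits, $N=2^A$).* The codebook $\mathcal P=\{0=p_0<p_1<\dots<p_{N-1}\}$ satisfies $\Pr(p_n<\eta\le p_{n+1}\mid\gamma_{\mathsf p}g_{\mathsf p}\ge\theta_{\mathsf p})=1/N$ for $0\le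 n\le N-2$ and $\Pr(\eta>p_{N-1}\mid\gamma_{\mathsf p}g_{\mathsf p}\ge\theta_{\mathsf p})=1/N$. With $\lfloor x\rfloor_{\mathcal P}=\max\{p\in\mathcal P:p\le x\}$, the quantized feedforward IPC signal is $\tilde\eta=\lfloor\acute\eta\rfloor_{\mathcal P}$ if $\omega\ge0$ and $\acute\eta<P_{\max}$, and $\tilde\eta=P_{\max}$ otherwise. *Beamformer and outage.* The orthogonal cognitive beamformer (OCB) $\mathbf f$ maximizes $|\mathbf f^\dagger\mathbf s_{\mathsf s}|^2$ subject to $\mathbf f^\dagger\hat{\mathbf s}_{\mathsf x}=0$ and $\|\mathbf f\|^2\le\tilde\eta$. The SU outage probability is $\acute P_{\mathsf{out}}=\Pr\big(\tfrac{g_{\mathsf s}}{\sigma^2}|\mathbf f^\dagger\mathbf s_{\mathsf s}|^2\le\theta_{\mathsf s}\big)$. **Statement.** With $\Gamma(s,x)=\int_x^\infty t^{s-1}e^{-t}\,dt$, $$\varphi=e^{-\theta_{\mathsf p}/\gamma_{\mathsf p}}\frac{(L-1)\lambda\theta_{\mathsf p}\theta_{\mathsf s}\Gamma(L-2,\theta_{\mathsf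 s}/\gamma_{\max})}{\gamma_{\mathsf p}\Gamma(L-1)},\qquad \alpha=e^{-\theta_{\mathsf p}/\gamma_{\mathsf p}}\frac{\Gamma(L-1,\theta_{\mathsf s}/\gamma_{\max})}{\Gamma(L-1)},$$ for OCB with feedforward and both quantized CDI and quantized IPC feedback $$\acute P_{\mathsf{out}}\le 1-\frac{\Gamma(L-1,\theta_{\mathsf s}/\gamma_{\max})}{\Gamma(L-1)}+\frac{\varphi\,2^{-B/(L-1)}+\alpha\,2^{-A}}{L-1}+O\big(2^{-2B/(L-1)}\big),$$ where the constant in $O(\cdot)$ depends only on $L,\lambda,\sigma^2,P_{\mathsf p},P_{\max},\theta_{\mathsf p},\theta_{\mathsf s}$; the bound holds for all integers $A,B\ge0$. -/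

import Mathlib

open MeasureTheory ProbabilityTheory Set

/-- The circularly symmetric complex Gaussian law `CN(0, v)`: real and imaginary parts are
independent real Gaussians with mean `0` and variance `v / 2`. -/
noncomputable def complexGaussian (v : NNReal) : Measure ℂ :=
  ((gaussianReal 0 (v / 2)).prod (gaussianReal 0 (v / 2))).map
    Complex.measurableEquivRealProd.symm

/-- The upper incomplete gamma function `Γ(s, x) = ∫_x^∞ t^(s-1) e^(-t) dt`. -/
noncomputable def upperGamma (s x : ℝ) : ℝ :=
  ∫ t in Ioi x, t ^ (s - 1) * Real.exp (-t)

/-- Deterministic parameters of the primary and the secondary link. -/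
structure LinkParams where
  /-- the relative path gain `λ` of the channel from the SU transmitter to the PU receiver -/
  pathGain : NNReal
  /-- the noise variance `σ²` -/
  noise : ℝ
  /-- the PU transmission power -/
  powerPU : ℝ
  /-- the maximum SU transmission power -/
  powerMax : ℝ
  /-- the PU decoding threshold `θ_p` -/
  thetaP : ℝ
  /-- the SU decoding threshold `θ_s` -/
  thetaS : ℝ
  pathGain_pos : 0 < pathGain
  pathGain_lt_one : pathGain < 1
  noise_pos : 0 < noise
  powerPU_pos : 0 < powerPU
  powerMax_pos : 0 < powerMax
  thetaP_pos : 0 < thetaP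
  thetaS_pos : 0 < thetaS

namespace LinkParams

variable (c : LinkParams)

/-- The PU transmit SNR `γ_p = P_p / σ²`. -/
noncomputable def gammaP : ℝ := c.powerPU / c.noise

/-- The maximum SU transmit SNR `γ_max = P_max / σ²`. -/
noncomputable def gammaMax : ℝ := c.powerMax / c.noise

/-- The coefficient
`φ = e^(-θ_p/γ_p) (L-1) λ θ_p θ_s Γ(L-2, θ_s/γ_max) / (γ_p Γ(L-1))`. -/
noncomputable def phi (L : ℕ) : ℝ :=
  Real.exp (-(c.thetaP / c.gammaP)) *
    ((((L : ℝ) - 1) * c.pathGain * c.thetaP * c.thetaS *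
        upperGamma ((L : ℝ) - 2) (c.thetaS / c.gammaMax)) /
      (c.gammaP * Real.Gamma ((L : ℝ) - 1)))

/-- The coefficient `α = e^(-θ_p/γ_p) Γ(L-1, θ_s/γ_max) / Γ(L-1)`. -/
noncomputable def alpha (L : ℕ) : ℝ :=
  Real.exp (-(c.thetaP / c.gammaP)) *
    (upperGamma ((L : ℝ) - 1) (c.thetaS / c.gammaMax) / Real.Gamma ((L : ℝ) - 1))

end LinkParams

/-- The channel shape `h / ‖h‖`. -/
noncomputable def channelShape {L : ℕ} (h : EuclideanSpace ℂ (Fin L)) :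
    EuclideanSpace ℂ (Fin L) :=
  ((‖h‖ : ℂ))⁻¹ • h

/-- The random block-fading channels, with `L` antennas at the SU transmitter, together with a
`B`-bit quantizer of the shape of the SU-to-PU channel. The quantizer may be randomized: its
output is a function of the channel shape and of a seed independent of all channels. Its
quantization error has the law of the sphere-cap model. -/
structure CognitiveLink (L : ℕ) (c : LinkParams) (B : ℕ) {Ω : Type*} [MeasurableSpace Ω]
    (μ : Measure Ω) where
  /-- the primary channel -/
  hp : Ω → ℂ
  /-- the channel from the SU transmitter to the PU receiver -/
  hx : Ω → EuclideanSpace ℂ (Fin L)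
  /-- the secondary channel -/
  hs : Ω → EuclideanSpace ℂ (Fin L)
  /-- the seed of the quantizer -/
  seed : Ω → ℝ
  /-- the quantizer of the channel shape -/
  quantizer : EuclideanSpace ℂ (Fin L) → ℝ → EuclideanSpace ℂ (Fin L)
  measurable_hp : Measurable hp
  measurable_hx : Measurable hx
  measurable_hs : Measurable hs
  measurable_seed : Measurable seed
  measurable_quantizer : Measurable (Function.uncurry quantizer)
  law_hp : μ.map hp = complexGaussian 1
  law_hx : ∀ i, μ.map (fun w => hx w i) = complexGaussian c.pathGain
  law_hs : ∀ i, μ.map (fun w => hs w i) = complexGaussian 1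
  indep_hx : iIndepFun (fun i w => hx w i) μ
  indep_hs : iIndepFun (fun i w => hs w i) μ
  /- The next three fields say that `hp`, `hx`, `hs`, `seed` are mutually independent. -/
  indep_hp_rest : IndepFun hp (fun w => (hx w, hs w, seed w)) μ
  indep_hx_rest : IndepFun hx (fun w => (hs w, seed w)) μ
  indep_hs_seed : IndepFun hs seed μ
  norm_quantizer : ∀ s u, ‖s‖ = 1 → ‖quantizer s u‖ = 1
  cdf_error : ∀ τ : ℝ, 0 ≤ τ → τ ≤ (2 : ℝ) ^ (-((B : ℝ) / ((L : ℝ) - 1))) →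
    μ.real {w | 1 - ‖inner ℂ (quantizer (channelShape (hx w)) (seed w))
        (channelShape (hx w))‖ ^ 2 ≤ τ} = 2 ^ B * τ ^ (L - 1)

namespace CognitiveLink

variable {L : ℕ} {c : LinkParams} {B : ℕ} {Ω : Type*} [MeasurableSpace Ω] {μ : Measure Ω}
  (S : CognitiveLink L c B μ)

/-- The primary channel power `g_p`. -/
noncomputable def gp (w : Ω) : ℝ := ‖S.hp w‖ ^ 2

/-- The normalized power `g_x = ‖h_x‖² / λ` of the SU-to-PU channel. -/
noncomputable def gx (w : Ω) : ℝ := ‖S.hx w‖ ^ 2 / c.pathGain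

/-- The secondary channel power `g_s`. -/
noncomputable def gs (w : Ω) : ℝ := ‖S.hs w‖ ^ 2

/-- The shape `s_x` of the SU-to-PU channel. -/
noncomputable def sx (w : Ω) : EuclideanSpace ℂ (Fin L) := channelShape (S.hx w)

/-- The shape `s_s` of the secondary channel. -/
noncomputable def ss (w : Ω) : EuclideanSpace ℂ (Fin L) := channelShape (S.hs w)

/-- The fed-back quantized channel direction `ŝ_x`. -/
noncomputable def sxHat (w : Ω) : EuclideanSpace ℂ (Fin L) := S.quantizer (S.sx w) (S.seed w)

/-- The quantization error `ε = 1 - |ŝ_x† s_x|²`. -/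
noncomputable def epsilon (w : Ω) : ℝ := 1 - ‖inner ℂ (S.sxHat w) (S.sx w)‖ ^ 2

/-- The unit vector `ŝ_⊥` orthogonal to `ŝ_x` with `s_s = a ŝ_x + b ŝ_⊥`: the normalized
projection of `s_s` onto the orthogonal complement of `ŝ_x`. -/
noncomputable def sPerp (w : Ω) : EuclideanSpace ℂ (Fin L) :=
  channelShape (S.ss w - inner ℂ (S.sxHat w) (S.ss w) • S.sxHat w)

/-- `δ = |s_x† ŝ_⊥|²`. -/
noncomputable def delta (w : Ω) : ℝ := ‖inner ℂ (S.sx w) (S.sPerp w)‖ ^ 2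

/-- The interference margin `ω = σ² (γ_p g_p / θ_p - 1)` of the PU receiver. -/
noncomputable def margin (w : Ω) : ℝ := c.noise * (c.gammaP * S.gp w / c.thetaP - 1)

open Classical in
/-- The unquantized IPC signal `η` without feedforward. -/
noncomputable def eta (w : Ω) : ℝ :=
  if 0 ≤ S.margin w then S.margin w / (c.pathGain * S.gx w * S.epsilon w) else c.powerMax

open Classical in
/-- The unquantized IPC signal with feedforward: `ε` is replaced by `δ`. -/
noncomputable def etaFF (w : Ω) : ℝ :=
  if 0 ≤ S.margin w then S.margin w / (c.pathGain * S.gx w * S.delta w) else c.powerMax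

/-- `p 0 < p 1 < ⋯ < p (2^A - 1)` is the equal-probability IPC codebook of size `N = 2^A`: it
starts at `p 0 = 0` and cuts the range of `η` into `N` cells of probability `1/N`,
given that the PU receiver is not in outage without interference (`γ_p g_p ≥ θ_p`). -/
structure IsIPCCodebook (A : ℕ) (p : ℕ → ℝ) : Prop where
  zero : p 0 = 0
  lt_succ : ∀ n, n + 1 < 2 ^ A → p n < p (n + 1)
  cell : ∀ n, n + 1 < 2 ^ A →
    (cond μ {w | c.thetaP ≤ c.gammaP * S.gp w}).real
      {w | p n < S.eta w ∧ S.eta w ≤ p (n + 1)} = 1 / 2 ^ A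
  last : (cond μ {w | c.thetaP ≤ c.gammaP * S.gp w}).real
      {w | p (2 ^ A - 1) < S.eta w} = 1 / 2 ^ A

/-- The operator `⌊x⌋_P`: the largest element of `{p 0, …, p (2^A - 1)}` that is at most `x`.
The supremum is over a finite set, nonempty for `x ≥ 0` since `p 0 = 0`. -/
noncomputable def codebookFloor (A : ℕ) (p : ℕ → ℝ) (x : ℝ) : ℝ :=
  sSup {q : ℝ | (∃ n, n < 2 ^ A ∧ p n = q) ∧ q ≤ x}

open Classical in
/-- The quantized IPC signal with feedforward. -/
noncomputable def etaFFQuant (A : ℕ) (p : ℕ → ℝ) (w : Ω) : ℝ :=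
  if 0 ≤ S.margin w ∧ S.etaFF w < c.powerMax then codebookFloor A p (S.etaFF w)
  else c.powerMax

/-- Feasible beamformers: orthogonal to `ŝ_x`, of power at most `P`. -/
def feasible (P : ℝ) (w : Ω) : Set (EuclideanSpace ℂ (Fin L)) :=
  {v | inner ℂ v (S.sxHat w) = 0 ∧ ‖v‖ ^ 2 ≤ P}

/-- `f` is the OCB beamformer under the power constraints `P`: in every state it maximizes
`|f† s_s|²` among the feasible beamformers. -/
def IsOCBBeamformer (P : Ω → ℝ) (f : Ω → EuclideanSpace ℂ (Fin L)) : Prop :=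
  ∀ w, f w ∈ S.feasible (P w) w ∧
    IsMaxOn (fun v => ‖inner ℂ v (S.ss w)‖ ^ 2) (S.feasible (P w) w) (f w)

/-- The receive SNR `g_s |f† s_s|² / σ²` of the SU receiver. -/
noncomputable def snrS (f : Ω → EuclideanSpace ℂ (Fin L)) (w : Ω) : ℝ :=
  S.gs w / c.noise * ‖inner ℂ (f w) (S.ss w)‖ ^ 2

/-- The SU outage probability `Pr(SNR_s ≤ θ_s)` under the beamformer `f`. -/
noncomputable def outageS (f : Ω → EuclideanSpace ℂ (Fin L)) : ℝ :=
  μ.real {w | S.snrS f w ≤ c.thetaS}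

end CognitiveLink

/-! Write `D = 2^(-B/(L-1))`, `G = ‖P h_s‖²` with `P` the projection onto the complement of `ŝ_x`,
`x = θ_s/γ_max` and `τ = θ_s σ²/G`. The normalized projection of `s_s`, scaled to full power, is a
feasible beamformer, so outage forces `η̃ ≤ τ` whenever `G > 0`. Hence an outage has one of three
causes: `G ≤ x`; or `G > x` and the unquantized feedforward signal is at most `τ`; or `G > x` and
that signal is below `P_max` and in the same codebook cell as `τ`, so that rounding down loses it.
The bound is the union bound over these.

Conditionally on everything but `h_p`, the margin `ω` satisfies `Pr(a < ω ≤ b) = e^(-T)(e^(-κa) -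
e^(-κb))` for `0 ≤ a ≤ b`, with `T = θ_p/γ_p` and `κ = T/σ²`. Events about `η` or the feedforward
signal are intervals for `ω` with endpoints proportional to `λ g_x ε` or `λ g_x δ`, so linearizing
the exponential reduces them to moments. Given `h_x` and the seed, `P h_s` is isotropic Gaussian in
dimension `L-1`; hence `G` is Gamma distributed with shape `L-1`, and the conditional mean of `δ`
given `G` is `ε/(L-1)`. Norm and direction of `h_x` are independent, so `E[g_x ε] = L · D(L-1)/L =
(L-1)D`. Together, `E[g_x δ | G] = D` (`lintegral_gx_delta_eq`). This gives the `φ` term, where the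
weight `1/G` on `G > x` produces `Γ(L-2, x)`.

For the third cause, a cell of length `ℓ` has feedforward probability at most `e^(-T) κ λ ℓ D`, even
jointly with `G` as a factor `Pr(G ∈ I)`. The same cell has `η`-probability `e^(-T) κ λ ℓ (L-1) D`
up to `O(D²)`, and the codebook makes this at most `e^(-T)/N`. Eliminating `ℓ` gives
`e^(-T)/((L-1)N) + O(D²)` per cell (`measure_quantization_loss_le`). The sets of `G` for which `τ`
lies in a given cell are disjoint, so summing over cells costs only the factor `Pr(G > x)` and no
factor `N`. -/

/-! ### Isotropic Gaussian laws and their polar decomposition -/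

section IsoGaussian

variable {V : Type*} [NormedAddCommGroup V] [InnerProductSpace ℝ V] [FiniteDimensional ℝ V]
  [MeasurableSpace V] [BorelSpace V]

/-- The density of the isotropic Gaussian law of total variance `v` per pair of dimensions. -/
noncomputable def isoGaussianDensity (V : Type*) [NormedAddCommGroup V] [InnerProductSpace ℝ V]
    (v : ℝ) (x : V) : ℝ :=
  (Real.pi * v) ^ (-(Module.finrank ℝ V / 2 : ℝ)) * Real.exp (-(‖x‖ ^ 2 / v))

/-- The isotropic Gaussian law on `V` with variance `v / 2` in each direction. -/
noncomputable def isoGaussian (V : Type*) [NormedAddCommGroup V] [InnerProductSpace ℝ V]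
    [FiniteDimensional ℝ V] [MeasurableSpace V] [BorelSpace V] (v : ℝ) : Measure V :=
  volume.withDensity fun x => ENNReal.ofReal (isoGaussianDensity V v x)

omit [FiniteDimensional ℝ V] [MeasurableSpace V] [BorelSpace V] in
lemma continuous_isoGaussianDensity (v : ℝ) : Continuous (isoGaussianDensity V v) := by
  unfold isoGaussianDensity; fun_prop

omit [FiniteDimensional ℝ V] [MeasurableSpace V] [BorelSpace V] in
lemma isoGaussianDensity_nonneg {v : ℝ} (hv : 0 < v) (x : V) : 0 ≤ isoGaussianDensity V v x := by
  unfold isoGaussianDensity; positivity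

lemma integral_isoGaussianDensity_mul_cexp {v : ℝ} (hv : 0 < v) (t : V) :
    ∫ x, (isoGaussianDensity V v x : ℂ) * Complex.exp (Complex.I * (inner ℝ t x : ℝ)) =
      Complex.exp (-(v * ‖t‖ ^ 2 / 4 : ℝ)) := by
  have h := GaussianFourier.integral_cexp_neg_mul_sq_norm_add (V := V) (b := ((1 / v : ℝ) : ℂ))
    (by simpa using hv) Complex.I t
  have e : ∀ x : V, (isoGaussianDensity V v x : ℂ) * Complex.exp (Complex.I * (inner ℝ t x : ℝ)) =
      (((Real.pi * v) ^ (-(Module.finrank ℝ V / 2 : ℝ)) : ℝ) : ℂ) *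
      Complex.exp (-((1 / v : ℝ) : ℂ) * ‖x‖ ^ 2 + Complex.I * (inner ℝ t x : ℝ)) := by
    intro x
    rw [isoGaussianDensity, Complex.exp_add, ← mul_assoc]
    congr 1
    push_cast
    congr 2
    ring
  simp_rw [e]
  rw [integral_const_mul, h, ← mul_assoc]
  have e1 : ((Real.pi : ℂ) / ((1 / v : ℝ) : ℂ)) ^ ((Module.finrank ℝ V : ℂ) / 2) =
      (((Real.pi * v) ^ (Module.finrank ℝ V / 2 : ℝ) : ℝ) : ℂ) := by
    rw [Complex.ofReal_cpow (by positivity)]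
    push_cast
    congr 1
    field_simp
  rw [e1, ← Complex.ofReal_mul, ← Real.rpow_add (by positivity)]
  simp only [neg_add_cancel, Real.rpow_zero, Complex.ofReal_one, one_mul, Complex.I_sq]
  congr 1
  have : (v : ℂ) ≠ 0 := by exact_mod_cast hv.ne'
  push_cast
  field_simp

lemma isProbabilityMeasure_isoGaussian {v : ℝ} (hv : 0 < v) :
    IsProbabilityMeasure (isoGaussian V v) := by
  have h := integral_isoGaussianDensity_mul_cexp hv (0 : V)
  simp only [inner_zero_left, Complex.ofReal_zero, mul_zero, Complex.exp_zero, mul_one, norm_zero,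
    ne_eq, OfNat.ofNat_ne_zero, not_false_eq_true, zero_pow, zero_div, neg_zero] at h
  rw [integral_complex_ofReal] at h
  have h1 : ∫ x, isoGaussianDensity V v x = 1 := by exact_mod_cast h
  -- A non-integrable function has integral `0` by convention, so the value `1` already proves
  -- integrability.
  have hi : Integrable (isoGaussianDensity V v) := by
    by_contra hc
    rw [integral_undef hc] at h1
    exact zero_ne_one h1
  constructor
  rw [isoGaussian, withDensity_apply _ MeasurableSet.univ, setLIntegral_univ,
    ← ofReal_integral_eq_lintegral_ofReal hi
      (Filter.Eventually.of_forall (isoGaussianDensity_nonneg hv)), h1, ENNReal.ofReal_one]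

lemma charFun_isoGaussian {v : ℝ} (hv : 0 < v) (t : V) :
    charFun (isoGaussian V v) t = Complex.exp (-(v * ‖t‖ ^ 2 / 4 : ℝ)) := by
  rw [← integral_isoGaussianDensity_mul_cexp hv t, charFun_apply, isoGaussian,
    integral_withDensity_eq_integral_toReal_smul
      (continuous_isoGaussianDensity v).measurable.ennreal_ofReal (by simp)]
  congr 1
  ext x
  rw [ENNReal.toReal_ofReal (isoGaussianDensity_nonneg hv x), real_inner_comm, Complex.real_smul,
    mul_comm Complex.I]

lemma lintegral_isoGaussian (v : ℝ) (F : V → ENNReal) (hF : Measurable F) :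
    ∫⁻ x, F x ∂(isoGaussian V v) =
      ∫⁻ x, ENNReal.ofReal (isoGaussianDensity V v x) * F x := by
  rw [isoGaussian, lintegral_withDensity_eq_lintegral_mul _
    (continuous_isoGaussianDensity v).measurable.ennreal_ofReal hF]
  rfl

/-- A coisometry maps the isotropic Gaussian law to the isotropic Gaussian law. -/
lemma measurePreserving_isoGaussian_of_adjoint {W : Type*} [NormedAddCommGroup W]
    [InnerProductSpace ℝ W] [FiniteDimensional ℝ W] [MeasurableSpace W] [BorelSpace W]
    {f : V → W} (hf : Measurable f) (g : W → V) (hg : ∀ t, ‖g t‖ = ‖t‖)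
    (hfg : ∀ x t, inner ℝ (f x) t = inner ℝ x (g t)) {v : ℝ} (hv : 0 < v) :
    MeasurePreserving f (isoGaussian V v) (isoGaussian W v) := by
  refine ⟨hf, ?_⟩
  have := isProbabilityMeasure_isoGaussian (V := V) hv
  have := isProbabilityMeasure_isoGaussian (V := W) hv
  have := Measure.isProbabilityMeasure_map (μ := isoGaussian V v) hf.aemeasurable
  -- The characteristic function depends on `t` only through `‖t‖`, and `g` moves `t` to the other
  -- side without changing its norm.
  refine Measure.ext_of_charFun ?_
  ext t
  rw [charFun_isoGaussian hv, charFun_apply, integral_map hf.aemeasurable (by fun_prop)]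
  simp_rw [hfg]
  rw [← charFun_apply, charFun_isoGaussian hv, hg]

lemma measurePreserving_isoGaussian {W : Type*} [NormedAddCommGroup W] [InnerProductSpace ℝ W]
    [FiniteDimensional ℝ W] [MeasurableSpace W] [BorelSpace W] (f : V ≃ₗᵢ[ℝ] W) {v : ℝ}
    (hv : 0 < v) : MeasurePreserving f (isoGaussian V v) (isoGaussian W v) :=
  measurePreserving_isoGaussian_of_adjoint f.continuous.measurable f.symm f.symm.norm_map
    (fun x t => by rw [← f.inner_map_map x, f.apply_symm_apply]) hv

lemma lintegral_eq_sphere_prod [Nontrivial V] (μ : Measure V) [μ.IsAddHaarMeasure]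
    (F : V → ENNReal) :
    ∫⁻ x, F x ∂μ = ∫⁻ y, F (y.2.1 • y.1.1)
      ∂(μ.toSphere.prod (Measure.volumeIoiPow (Module.finrank ℝ V - 1))) := by
  have h := μ.measurePreserving_homeomorphUnitSphereProd.lintegral_comp_emb
    (Homeomorph.measurableEmbedding _)
    (fun y : Metric.sphere (0 : V) 1 × Ioi (0 : ℝ) => F (y.2.1 • y.1.1))
  rw [← h, ← setLIntegral_univ, setLIntegral_congr (s := univ) (t := {(0 : V)}ᶜ),
    ← lintegral_subtype_comap (measurableSet_singleton _).compl]
  · refine lintegral_congr fun x => ?_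
    have : ‖(x : V)‖ ≠ 0 := norm_ne_zero_iff.2 x.2
    simp [smul_smul, this]
  · exact (ae_eq_univ.2 (by simp)).symm

lemma lintegral_gamma_density (k : ℕ) :
    ∫⁻ t in Ioi (0 : ℝ), ENNReal.ofReal (t ^ k * Real.exp (-t) / k.factorial) = 1 := by
  have hG : ∫ t in Ioi (0 : ℝ), t ^ k * Real.exp (-t) / k.factorial = 1 := by
    rw [integral_div, ← Real.Gamma_nat_eq_factorial, Real.Gamma_eq_integral (by positivity)]
    have : ∫ t in Ioi (0 : ℝ), t ^ k * Real.exp (-t) =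
        ∫ t in Ioi (0 : ℝ), Real.exp (-t) * t ^ ((k : ℝ) + 1 - 1) := by
      refine setIntegral_congr_fun measurableSet_Ioi fun t _ => ?_
      simp [mul_comm]
    rw [this, ← Real.Gamma_eq_integral (by positivity)]
    exact div_self (Real.Gamma_pos_of_pos (by positivity)).ne'
  rw [← ofReal_integral_eq_lintegral_ofReal, hG, ENNReal.ofReal_one]
  · by_contra hc
    rw [integral_undef hc] at hG
    exact zero_ne_one hG
  · refine (ae_restrict_mem measurableSet_Ioi).mono fun t ht => ?_
    have : (0 : ℝ) < t := ht
    simp only [Pi.zero_apply]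
    positivity

/-- Substitution `t = r²/v`. Only the independence of `κ` from `φ` matters: the test function `1`
later fixes it by total mass. -/
lemma lintegral_gamma_eq_radial {v c : ℝ} (hv : 0 < v) (hc : 0 < c) (k : ℕ) :
    ∃ κ : ENNReal, ∀ φ : ℝ → ENNReal, Measurable φ →
    ∫⁻ t in Ioi (0 : ℝ), ENNReal.ofReal (t ^ k * Real.exp (-t) / k.factorial) * φ (v * t) =
      κ * ∫⁻ r : Ioi (0 : ℝ), ENNReal.ofReal (c * Real.exp (-(r.1 ^ 2 / v))) * φ (r.1 ^ 2)
        ∂(Measure.volumeIoiPow (2 * k + 1)) := by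
  -- The Jacobian `2r/v` times `(r²/v)^k / k!` is `2 r^(2k+1) / (v^(k+1) k!)`; the factor `c` of the
  -- radial density is divided out.
  refine ⟨ENNReal.ofReal (2 / (v ^ (k + 1) * k.factorial * c)), fun φ hφ => ?_⟩
  have himg : (fun r : ℝ => r ^ 2 / v) '' Ioi 0 = Ioi 0 := by
    ext t
    constructor
    · rintro ⟨r, hr, rfl⟩
      have : (0 : ℝ) < r := hr
      exact mem_Ioi.2 (by positivity)
    · intro ht
      have : (0 : ℝ) < t := ht
      refine ⟨√(v * t), Real.sqrt_pos.2 (by positivity), ?_⟩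
      simp only
      rw [Real.sq_sqrt (by positivity)]
      field_simp
  have hsub := lintegral_image_eq_lintegral_abs_deriv_mul (s := Ioi 0)
    (f := fun r : ℝ => r ^ 2 / v) (f' := fun r => 2 * r / v) measurableSet_Ioi ?_ ?_
    (fun t => ENNReal.ofReal (t ^ k * Real.exp (-t) / k.factorial) * φ (v * t))
  rotate_left
  · intro r _
    have := ((hasDerivAt_pow 2 r).div_const v).hasDerivWithinAt (s := Ioi 0)
    simpa using this
  · intro a ha b hb hab
    have ha' : (0 : ℝ) < a := ha
    have hb' : (0 : ℝ) < b := hb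
    have : a ^ 2 = b ^ 2 := by
      have := congrArg (· * v) hab
      simpa [hv.ne'] using this
    exact (pow_left_inj₀ ha'.le hb'.le two_ne_zero).1 this
  rw [himg] at hsub
  rw [hsub, Measure.volumeIoiPow, lintegral_withDensity_eq_lintegral_mul _ (by fun_prop)
    (by fun_prop)]
  simp only [Pi.mul_apply]
  rw [lintegral_subtype_comap measurableSet_Ioi
    (fun r : ℝ => ENNReal.ofReal (r ^ (2 * k + 1)) *
      (ENNReal.ofReal (c * Real.exp (-(r ^ 2 / v))) * φ (r ^ 2))),
    ← lintegral_const_mul' _ _ ENNReal.ofReal_ne_top]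
  refine setLIntegral_congr_fun measurableSet_Ioi fun r hr => ?_
  have hr' : (0 : ℝ) < r := hr
  rw [← mul_assoc, ← mul_assoc, ← mul_assoc, ← ENNReal.ofReal_mul (by positivity),
    ← ENNReal.ofReal_mul (by positivity), ← ENNReal.ofReal_mul (by positivity)]
  congr 1
  · congr 1
    rw [abs_of_pos (by positivity), div_pow, ← pow_mul, pow_succ v, pow_succ r]
    field_simp
    ring
  · congr 1
    field_simp

/-- Norm and direction of an isotropic Gaussian vector are independent, and the normalized squared
norm has a Gamma law. -/
lemma isoGaussian_radial [Nontrivial V] {k : ℕ} (hk : Module.finrank ℝ V = 2 * (k + 1)) {v : ℝ}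
    (hv : 0 < v) {φ : ℝ → ENNReal} (hφ : Measurable φ) {ψ : V → ENNReal} (hψ : Measurable ψ) :
    ∫⁻ x, φ (‖x‖ ^ 2) * ψ (‖x‖⁻¹ • x) ∂(isoGaussian V v) =
      (∫⁻ x, ψ (‖x‖⁻¹ • x) ∂(isoGaussian V v)) *
        ∫⁻ t in Ioi (0 : ℝ), ENNReal.ofReal (t ^ k * Real.exp (-t) / k.factorial) * φ (v * t) := by
  set c : ℝ := (Real.pi * v) ^ (-(Module.finrank ℝ V / 2 : ℝ)) with hc
  have hc0 : 0 < c := by positivity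
  obtain ⟨κ, hκ⟩ := lintegral_gamma_eq_radial hv hc0 k
  have key : ∀ φ : ℝ → ENNReal, Measurable φ →
      ∫⁻ x, φ (‖x‖ ^ 2) * ψ (‖x‖⁻¹ • x) ∂(isoGaussian V v) =
      (∫⁻ s, ψ s.1 ∂((volume : Measure V).toSphere)) *
      ∫⁻ r : Ioi (0 : ℝ), ENNReal.ofReal (c * Real.exp (-(r.1 ^ 2 / v))) * φ (r.1 ^ 2)
        ∂(Measure.volumeIoiPow (2 * k + 1)) := by
    intro φ hφ
    rw [lintegral_isoGaussian _ _ (by fun_prop), lintegral_eq_sphere_prod,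
      ← lintegral_prod_mul (by fun_prop) (by fun_prop), hk,
      show 2 * (k + 1) - 1 = 2 * k + 1 by omega]
    refine lintegral_congr fun y => ?_
    have h1 : ‖(y.1 : V)‖ = 1 := by simp
    have h2 : (0 : ℝ) < y.2.1 := y.2.2
    rw [isoGaussianDensity, norm_smul, h1, mul_one, Real.norm_of_nonneg h2.le, smul_smul,
      inv_mul_cancel₀ h2.ne', one_smul]
    ring
  -- With `φ = 1` the Gamma density has mass one, so `κ` is inverse to the radial mass and the
  -- unknown constants cancel.
  have k1 := key (fun _ => 1) measurable_const
  simp only [one_mul] at k1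
  have k2 := hκ (fun _ => 1) measurable_const
  simp only [mul_one] at k2 k1
  rw [lintegral_gamma_density] at k2
  rw [key φ hφ, k1, hκ φ hφ, mul_assoc, mul_left_comm _ κ, ← mul_assoc κ, ← k2, one_mul]

lemma lintegral_norm_sq_isoGaussian [Nontrivial V] {k : ℕ}
    (hk : Module.finrank ℝ V = 2 * (k + 1)) {v : ℝ} (hv : 0 < v) {φ : ℝ → ENNReal}
    (hφ : Measurable φ) :
    ∫⁻ x, φ (‖x‖ ^ 2) ∂(isoGaussian V v) =
      ∫⁻ t in Ioi (0 : ℝ), ENNReal.ofReal (t ^ k * Real.exp (-t) / k.factorial) * φ (v * t) := by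
  have := isProbabilityMeasure_isoGaussian (V := V) hv
  simpa using isoGaussian_radial hk hv hφ (ψ := fun _ => 1) measurable_const

end IsoGaussian

/-! ### Channel vectors with i.i.d. complex Gaussian entries are isotropic -/

lemma charFun_complexGaussian (v : NNReal) (t : ℂ) :
    charFun (complexGaussian v) t = Complex.exp (-(v * ‖t‖ ^ 2 / 4 : ℝ)) := by
  rw [charFun_apply, complexGaussian, integral_map (by fun_prop) (by fun_prop)]
  have e : ∀ x : ℝ × ℝ, Complex.exp ((inner ℝ (Complex.measurableEquivRealProd.symm x) t : ℝ) *
      Complex.I) = Complex.exp ((inner ℝ x.1 t.re : ℝ) * Complex.I) *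
        Complex.exp ((inner ℝ x.2 t.im : ℝ) * Complex.I) := by
    intro x
    rw [← Complex.exp_add]
    congr 1
    simp [Complex.inner, Complex.measurableEquivRealProd]
    ring
  simp_rw [e]
  rw [integral_prod_mul (fun x : ℝ => Complex.exp ((inner ℝ x t.re : ℝ) * Complex.I))
    (fun x : ℝ => Complex.exp ((inner ℝ x t.im : ℝ) * Complex.I)), ← charFun_apply,
    ← charFun_apply, charFun_gaussianReal, charFun_gaussianReal, ← Complex.exp_add]
  congr 1
  rw [← Complex.normSq_eq_norm_sq, Complex.normSq_apply]
  push_cast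
  ring

instance (v : NNReal) : IsProbabilityMeasure (complexGaussian v) :=
  Measure.isProbabilityMeasure_map (by fun_prop)

lemma complexGaussian_eq_isoGaussian {v : NNReal} (hv : 0 < v) :
    complexGaussian v = isoGaussian ℂ v := by
  have := isProbabilityMeasure_isoGaussian (V := ℂ) (v := v) hv
  refine Measure.ext_of_charFun ?_
  ext t
  rw [charFun_complexGaussian, charFun_isoGaussian (by exact_mod_cast hv)]

lemma map_pi_complexGaussian {ι : Type*} [Fintype ι] {v : NNReal} (hv : 0 < v) :
    (Measure.pi fun _ : ι => complexGaussian v).map (WithLp.toLp 2) =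
      isoGaussian (EuclideanSpace ℂ ι) v := by
  have := isProbabilityMeasure_isoGaussian (V := EuclideanSpace ℂ ι) (v := v) hv
  have := Measure.isProbabilityMeasure_map (μ := Measure.pi fun _ : ι => complexGaussian v)
    (f := WithLp.toLp 2) (by fun_prop)
  refine Measure.ext_of_charFun ?_
  ext t
  rw [charFun_pi, charFun_isoGaussian (by exact_mod_cast hv), EuclideanSpace.norm_sq_eq]
  simp_rw [charFun_complexGaussian]
  rw [← Complex.exp_sum]
  congr 1
  push_cast
  rw [Finset.mul_sum, Finset.sum_div, Finset.sum_neg_distrib]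

lemma map_eq_isoGaussian {ι : Type*} [Fintype ι] {v : NNReal} (hv : 0 < v) {Ω : Type*}
    [MeasurableSpace Ω] {μ : Measure Ω} [IsProbabilityMeasure μ] {h : Ω → EuclideanSpace ℂ ι}
    (hm : Measurable h) (hl : ∀ i, μ.map (fun w => h w i) = complexGaussian v)
    (hi : iIndepFun (fun i w => h w i) μ) : μ.map h = isoGaussian (EuclideanSpace ℂ ι) v := by
  have h1 := (iIndepFun_iff_map_fun_eq_pi_map (fun i => by fun_prop)).1 hi
  simp_rw [hl] at h1
  rw [← map_pi_complexGaussian hv, ← h1, Measure.map_map (by fun_prop) (by fun_prop)]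
  rfl

/-! ### Projection onto the complement of the quantized direction -/

section Perp

variable {E : Type*} [NormedAddCommGroup E] [InnerProductSpace ℂ E]

/-- The projection of `h` onto the orthogonal complement of the unit vector `q`. -/
noncomputable def perp (q h : E) : E := h - inner ℂ q h • q

lemma inner_perp_right {q : E} (hq : ‖q‖ = 1) (h : E) : inner ℂ q (perp q h) = 0 := by
  simp [perp, inner_self_eq_norm_sq_to_K, hq]

lemma inner_perp_comm (q s h : E) : inner ℂ s (perp q h) = inner ℂ (perp q s) h := by
  simp [perp]

lemma norm_perp_sq {q : E} (hq : ‖q‖ = 1) (s : E) :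
    ‖perp q s‖ ^ 2 = ‖s‖ ^ 2 - ‖inner ℂ q s‖ ^ 2 := by
  have h := norm_add_sq_eq_norm_sq_add_norm_sq_of_inner_eq_zero (𝕜 := ℂ) (perp q s)
    (inner ℂ q s • q)
    (by rw [inner_smul_right, inner_eq_zero_symm.1 (inner_perp_right hq s), mul_zero])
  rw [perp, sub_add_cancel, norm_smul, hq, mul_one] at h
  rw [perp]
  nlinarith

lemma perp_smul (q h : E) (a : ℂ) : perp q (a • h) = a • perp q h := by
  simp [perp, smul_sub, mul_smul]

end Perp

lemma channelShape_smul {L : ℕ} {a : ℝ} (ha : 0 < a) (h : EuclideanSpace ℂ (Fin L)) :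
    channelShape ((a : ℂ) • h) = channelShape h := by
  unfold channelShape
  rw [norm_smul, smul_smul, Complex.norm_real, Real.norm_of_nonneg ha.le]
  congr 1
  push_cast
  have : (a : ℂ) ≠ 0 := by exact_mod_cast ha.ne'
  field_simp

lemma norm_channelShape {L : ℕ} {h : EuclideanSpace ℂ (Fin L)} (hh : h ≠ 0) :
    ‖channelShape h‖ = 1 := by
  have : ‖h‖ ≠ 0 := norm_ne_zero_iff.2 hh
  simp [channelShape, norm_smul, this]

lemma channelShape_perp_channelShape {L : ℕ} (q h : EuclideanSpace ℂ (Fin L)) :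
    channelShape (perp q (channelShape h)) = channelShape (perp q h) := by
  rcases eq_or_ne h 0 with rfl | hh
  · simp [channelShape, perp]
  · have e : channelShape h = ((‖h‖⁻¹ : ℝ) : ℂ) • h := by simp [channelShape]
    rw [e, perp_smul, channelShape_smul (inv_pos.2 (norm_pos_iff.2 hh))]

lemma norm_inner_channelShape_sq {L : ℕ} (s h : EuclideanSpace ℂ (Fin L)) :
    ‖inner ℂ s (channelShape h)‖ ^ 2 = ‖inner ℂ s h‖ ^ 2 / ‖h‖ ^ 2 := by
  simp [channelShape, mul_pow, div_eq_inv_mul]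

lemma finrank_real_euclideanSpace_complex (k : ℕ) :
    Module.finrank ℝ (EuclideanSpace ℂ (Fin k)) = 2 * k := by
  rw [finrank_real_of_complex, finrank_euclideanSpace_fin]

lemma isoGaussian_singleton {k : ℕ} {v : ℝ} (x : EuclideanSpace ℂ (Fin (k + 1))) :
    isoGaussian (EuclideanSpace ℂ (Fin (k + 1))) v {x} = 0 :=
  withDensity_absolutelyContinuous _ _ (measure_singleton x)

/-- Dropping the first coordinate preserves isotropic Gaussian laws. -/
lemma measurePreserving_tail (k : ℕ) {v : ℝ} (hv : 0 < v) :
    MeasurePreserving (fun x : EuclideanSpace ℂ (Fin (k + 1)) =>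
        (WithLp.toLp 2 fun j : Fin k => x j.succ : EuclideanSpace ℂ (Fin k)))
      (isoGaussian (EuclideanSpace ℂ (Fin (k + 1))) v)
      (isoGaussian (EuclideanSpace ℂ (Fin k)) v) := by
  refine measurePreserving_isoGaussian_of_adjoint (by fun_prop)
    (fun t => WithLp.toLp 2 (Fin.cons 0 fun j => t j)) (fun t => ?_) (fun x t => ?_) hv
  · rw [EuclideanSpace.norm_eq, EuclideanSpace.norm_eq, Fin.sum_univ_succ]
    simp
  · simp [PiLp.inner_apply, Fin.sum_univ_succ]

/-- A complex linear isometry equivalence as a real one. -/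
def realIsometry {E F : Type*} [NormedAddCommGroup E] [NormedAddCommGroup F] [NormedSpace ℂ E]
    [NormedSpace ℂ F] [NormedSpace ℝ E] [NormedSpace ℝ F] [IsScalarTower ℝ ℂ E]
    [IsScalarTower ℝ ℂ F] (f : E ≃ₗᵢ[ℂ] F) : E ≃ₗᵢ[ℝ] F where
  toLinearEquiv := f.toLinearEquiv.restrictScalars ℝ
  norm_map' := f.norm_map

/-- The `k + 1` coordinate ratios have equal weighted means, because swapping coordinates is an
isometry, and they sum to one. -/
lemma lintegral_coord_ratio (k : ℕ) (j : Fin (k + 1)) {φ : ℝ → ENNReal} (hφ : Measurable φ) :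
    ∫⁻ y, ENNReal.ofReal (‖y j‖ ^ 2 / ‖y‖ ^ 2) * φ (‖y‖ ^ 2)
        ∂(isoGaussian (EuclideanSpace ℂ (Fin (k + 1))) 1) =
      ENNReal.ofReal (1 / (k + 1 : ℝ)) *
        ∫⁻ t in Ioi (0 : ℝ), ENNReal.ofReal (t ^ k * Real.exp (-t) / k.factorial) * φ t := by
  have hsym : ∀ i, ∫⁻ y, ENNReal.ofReal (‖y i‖ ^ 2 / ‖y‖ ^ 2) * φ (‖y‖ ^ 2)
        ∂(isoGaussian (EuclideanSpace ℂ (Fin (k + 1))) 1) =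
      ∫⁻ y, ENNReal.ofReal (‖y j‖ ^ 2 / ‖y‖ ^ 2) * φ (‖y‖ ^ 2)
        ∂(isoGaussian (EuclideanSpace ℂ (Fin (k + 1))) 1) := by
    intro i
    have hp := measurePreserving_isoGaussian
      (LinearIsometryEquiv.piLpCongrLeft 2 ℝ ℂ (Equiv.swap i j)) (v := 1) one_pos
    rw [← hp.lintegral_comp (f := fun y : EuclideanSpace ℂ (Fin (k + 1)) =>
      ENNReal.ofReal (‖y j‖ ^ 2 / ‖y‖ ^ 2) * φ (‖y‖ ^ 2)) (by fun_prop)]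
    refine lintegral_congr fun y => ?_
    rw [LinearIsometryEquiv.norm_map]
    simp [LinearIsometryEquiv.piLpCongrLeft_apply, Equiv.piCongrLeft'_apply]
  have hsum : ∑ i, ∫⁻ y, ENNReal.ofReal (‖y i‖ ^ 2 / ‖y‖ ^ 2) * φ (‖y‖ ^ 2)
        ∂(isoGaussian (EuclideanSpace ℂ (Fin (k + 1))) 1) =
      ∫⁻ y, φ (‖y‖ ^ 2) ∂(isoGaussian (EuclideanSpace ℂ (Fin (k + 1))) 1) := by
    rw [← lintegral_finsetSum _ (fun i _ => by fun_prop)]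
    refine lintegral_congr_ae ?_
    -- At the origin every ratio is `0 / 0 = 0`, so the sum is one only almost everywhere.
    have h0 : ∀ᵐ y ∂(isoGaussian (EuclideanSpace ℂ (Fin (k + 1))) 1), y ≠ 0 := by
      rw [ae_iff]; simpa using isoGaussian_singleton (k := k) (v := 1) 0
    filter_upwards [h0] with y hy
    rw [← Finset.sum_mul, ← ENNReal.ofReal_sum_of_nonneg (fun i _ => by positivity),
      ← Finset.sum_div, ← EuclideanSpace.norm_sq_eq, div_self (by simpa using hy),
      ENNReal.ofReal_one, one_mul]
  rw [Finset.sum_congr rfl fun i _ => hsym i, Finset.sum_const, Finset.card_univ,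
    Fintype.card_fin, lintegral_norm_sq_isoGaussian
      (finrank_real_euclideanSpace_complex (k + 1)) one_pos hφ] at hsum
  simp only [one_mul] at hsum
  rw [← hsum, nsmul_eq_mul, ← mul_assoc, ← ENNReal.ofReal_natCast (k + 1),
    ← ENNReal.ofReal_mul (by positivity)]
  push_cast
  rw [one_div, inv_mul_cancel₀ (by positivity), ENNReal.ofReal_one, one_mul]

/-- For unit vectors `q`, `s` there is a measure-preserving change of coordinates in which
the projection onto the complement of `q` has free coordinates, the first of which is along the
projection of `s`. -/
lemma exists_perp_coordinates {k : ℕ} {q : EuclideanSpace ℂ (Fin (k + 2))} (hq : ‖q‖ = 1)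
    (s : EuclideanSpace ℂ (Fin (k + 2))) :
    ∃ F : EuclideanSpace ℂ (Fin (k + 2)) → EuclideanSpace ℂ (Fin (k + 1)),
      MeasurePreserving F (isoGaussian _ 1) (isoGaussian _ 1) ∧
      (∀ h, ‖perp q h‖ = ‖F h‖) ∧
      ∀ h, ‖inner ℂ s (perp q h)‖ = ‖perp q s‖ * ‖F h 0‖ := by
  obtain ⟨b, hb0, hb1⟩ : ∃ b : OrthonormalBasis (Fin (k + 2)) ℂ (EuclideanSpace ℂ (Fin (k + 2))),
      b 0 = q ∧ (‖perp q s‖ : ℂ) • b 1 = perp q s := by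
    -- When `s` is parallel to `q` there is no direction to adapt to, and any orthonormal basis
    -- starting with `q` will do.
    by_cases hs : perp q s = 0
    · obtain ⟨b, hb⟩ := Orthonormal.exists_orthonormalBasis_extension_of_card_eq (𝕜 := ℂ)
        (E := EuclideanSpace ℂ (Fin (k + 2))) (ι := Fin (k + 2)) (by simp) (v := fun _ => q)
        (s := {0}) ⟨fun i => hq, fun i j hij => absurd (Subsingleton.elim i j) hij⟩
      exact ⟨b, hb 0 rfl, by simp [hs]⟩
    · obtain ⟨b, hb⟩ := Orthonormal.exists_orthonormalBasis_extension_of_card_eq (𝕜 := ℂ)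
        (E := EuclideanSpace ℂ (Fin (k + 2))) (ι := Fin (k + 2)) (by simp)
        (v := fun i => if i = 0 then q else channelShape (perp q s)) (s := {0, 1}) (by
          have hort : inner ℂ q (channelShape (perp q s)) = 0 := by
            rw [channelShape, inner_smul_right, inner_perp_right hq, mul_zero]
          constructor
          · rintro ⟨i, rfl | rfl⟩
            · simpa using hq
            · simpa using norm_channelShape hs
          · rintro ⟨i, rfl | rfl⟩ ⟨j, rfl | rfl⟩ hij
            · exact absurd rfl hij
            · simpa using hort
            · simpa using inner_eq_zero_symm.1 hort
            · exact absurd rfl hij)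
      refine ⟨b, by simpa using hb 0 (by simp), ?_⟩
      rw [hb 1 (by simp)]
      have : (‖perp q s‖ : ℂ) ≠ 0 := by simpa using hs
      simp [channelShape, smul_smul, this]
  -- In this basis the projection just deletes coordinate `0`.
  have hcoord : ∀ h, ∀ j : Fin (k + 1), b.repr (perp q h) j.succ = b.repr h j.succ := by
    intro h j
    have : b.repr q j.succ = 0 := by rw [← hb0, b.repr_self]; simp
    simp [perp, this]
  have hcoord0 : ∀ h, b.repr (perp q h) 0 = 0 := by
    intro h
    rw [b.repr_apply_apply, hb0, inner_perp_right hq]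
  refine ⟨fun h => WithLp.toLp 2 fun j : Fin (k + 1) => b.repr h j.succ, ?_, fun h => ?_,
    fun h => ?_⟩
  · exact (measurePreserving_tail (k + 1) one_pos).comp
      (measurePreserving_isoGaussian (realIsometry b.repr) one_pos)
  · rw [← b.repr.norm_map, EuclideanSpace.norm_eq, EuclideanSpace.norm_eq, Fin.sum_univ_succ,
      hcoord0]
    simp [hcoord]
  · rw [inner_perp_comm, ← hb1, inner_smul_left, norm_mul]
    simp [b.repr_apply_apply, hb1]

/-- `|s† u|²` for the direction `u` of the projection of an isotropic `h` onto the complement of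
`q`: its mean is the fraction `1 / (k + 1)` of the squared norm of the projection of `s`, also
conditionally on the squared norm of the projection of `h`, which has a Gamma law. -/
lemma lintegral_inner_perp {k : ℕ} {q : EuclideanSpace ℂ (Fin (k + 2))} (hq : ‖q‖ = 1)
    (s : EuclideanSpace ℂ (Fin (k + 2))) {φ : ℝ → ENNReal} (hφ : Measurable φ) :
    ∫⁻ h, ENNReal.ofReal (‖inner ℂ s (channelShape (perp q (channelShape h)))‖ ^ 2) *
        φ (‖perp q h‖ ^ 2) ∂(isoGaussian (EuclideanSpace ℂ (Fin (k + 2))) 1) =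
      ENNReal.ofReal (‖perp q s‖ ^ 2 / (k + 1 : ℝ)) *
        ∫⁻ t in Ioi (0 : ℝ), ENNReal.ofReal (t ^ k * Real.exp (-t) / k.factorial) * φ t := by
  obtain ⟨F, hF, h1, h2⟩ := exists_perp_coordinates hq s
  simp_rw [channelShape_perp_channelShape, norm_inner_channelShape_sq, h1, h2]
  rw [hF.lintegral_comp (f := fun y => ENNReal.ofReal ((‖perp q s‖ * ‖y 0‖) ^ 2 / ‖y‖ ^ 2) *
    φ (‖y‖ ^ 2)) (by fun_prop)]
  have e : ∀ y : EuclideanSpace ℂ (Fin (k + 1)),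
      ENNReal.ofReal ((‖perp q s‖ * ‖y 0‖) ^ 2 / ‖y‖ ^ 2) * φ (‖y‖ ^ 2) =
      ENNReal.ofReal (‖perp q s‖ ^ 2) *
        (ENNReal.ofReal (‖y 0‖ ^ 2 / ‖y‖ ^ 2) * φ (‖y‖ ^ 2)) := by
    intro y
    rw [← mul_assoc, ← ENNReal.ofReal_mul (by positivity)]
    congr 2
    ring
  simp_rw [e]
  rw [lintegral_const_mul' _ _ ENNReal.ofReal_ne_top, lintegral_coord_ratio k 0 hφ, ← mul_assoc,
    ← ENNReal.ofReal_mul (by positivity), mul_one_div, h1 s]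

lemma lintegral_norm_perp {k : ℕ} {q : EuclideanSpace ℂ (Fin (k + 2))} (hq : ‖q‖ = 1)
    {φ : ℝ → ENNReal} (hφ : Measurable φ) :
    ∫⁻ h, φ (‖perp q h‖ ^ 2) ∂(isoGaussian (EuclideanSpace ℂ (Fin (k + 2))) 1) =
      ∫⁻ t in Ioi (0 : ℝ), ENNReal.ofReal (t ^ k * Real.exp (-t) / k.factorial) * φ t := by
  obtain ⟨F, hF, h1, -⟩ := exists_perp_coordinates hq 0
  simp_rw [h1]
  rw [hF.lintegral_comp (f := fun y => φ (‖y‖ ^ 2)) (by fun_prop), lintegral_norm_sq_isoGaussian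
    (finrank_real_euclideanSpace_complex (k + 1)) one_pos hφ]
  simp

lemma ae_inner_channelShape_perp_ne_zero {k : ℕ} {q : EuclideanSpace ℂ (Fin (k + 2))}
    (hq : ‖q‖ = 1) {s : EuclideanSpace ℂ (Fin (k + 2))} (hs : perp q s ≠ 0) :
    ∀ᵐ h ∂(isoGaussian (EuclideanSpace ℂ (Fin (k + 2))) 1),
      ‖inner ℂ s (channelShape (perp q (channelShape h)))‖ ^ 2 ≠ 0 := by
  obtain ⟨F, hF, h1, h2⟩ := exists_perp_coordinates hq s
  have h0 : ∀ᵐ y ∂(isoGaussian (EuclideanSpace ℂ (Fin (k + 1))) 1), y 0 ≠ 0 := by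
    refine withDensity_absolutelyContinuous _ _ ?_
    -- The exceptional set is the kernel of a nonzero real-linear map, a proper subspace and hence
    -- null.
    let p : EuclideanSpace ℂ (Fin (k + 1)) →ₗ[ℝ] ℂ :=
      { toFun := fun y => y 0, map_add' := fun _ _ => rfl, map_smul' := fun _ _ => rfl }
    have hp : LinearMap.ker p ≠ ⊤ := by
      intro h
      have : EuclideanSpace.single 0 1 ∈ LinearMap.ker p := h ▸ Submodule.mem_top
      have h1 : (EuclideanSpace.single (0 : Fin (k + 1)) (1 : ℂ)) 0 = 0 := LinearMap.mem_ker.1 this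
      simp at h1
    refine (congrArg _ ?_).trans (Measure.addHaar_submodule volume _ hp)
    ext y
    exact not_not
  filter_upwards [hF.quasiMeasurePreserving.ae h0] with h hh
  have hs' := norm_ne_zero_iff.2 hs
  have hFh : F h ≠ 0 := fun h => hh (by simp [h])
  rw [channelShape_perp_channelShape, norm_inner_channelShape_sq, h1, h2]
  positivity

/-! ### Integrating out one independent variable -/

lemma lintegral_comp_of_indepFun {Ω α β : Type*} [MeasurableSpace Ω] [MeasurableSpace α]
    [MeasurableSpace β] {μ : Measure Ω} [IsProbabilityMeasure μ] {X : Ω → α} {Y : Ω → β}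
    (hX : Measurable X) (hY : Measurable Y) (h : IndepFun X Y μ) {F : α × β → ENNReal}
    (hF : Measurable F) :
    ∫⁻ w, F (X w, Y w) ∂μ = ∫⁻ w, ∫⁻ x, F (x, Y w) ∂(μ.map X) ∂μ := by
  have := Measure.isProbabilityMeasure_map (μ := μ) hX.aemeasurable
  have := Measure.isProbabilityMeasure_map (μ := μ) hY.aemeasurable
  have hm := (indepFun_iff_map_prod_eq_prod_map_map hX.aemeasurable hY.aemeasurable).1 h
  rw [← lintegral_map (f := F) (g := fun w => (X w, Y w)) hF (by fun_prop), hm,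
    lintegral_prod_symm _ hF.aemeasurable,
    lintegral_map (f := fun y => ∫⁻ x, F (x, y) ∂(μ.map X)) hF.lintegral_prod_left' hY]

/-- This serves to average over `h_s` with `h_x` and the seed frozen, although independence is given
as a chain that splits off `h_x` first. -/
lemma lintegral_comp_of_indepFun_of_indepFun {Ω α β δ : Type*} [MeasurableSpace Ω]
    [MeasurableSpace α] [MeasurableSpace β] [MeasurableSpace δ] {μ : Measure Ω}
    [IsProbabilityMeasure μ] {X : Ω → α} {Y : Ω → β} {Z : Ω → δ} (hX : Measurable X)
    (hY : Measurable Y) (hZ : Measurable Z) (h : IndepFun X (fun w => (Y w, Z w)) μ)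
    (h' : IndepFun Y Z μ) {F : β × α × δ → ENNReal} (hF : Measurable F) :
    ∫⁻ w, F (Y w, X w, Z w) ∂μ = ∫⁻ w, ∫⁻ y, F (y, X w, Z w) ∂(μ.map Y) ∂μ := by
  have := Measure.isProbabilityMeasure_map (μ := μ) hX.aemeasurable
  have := Measure.isProbabilityMeasure_map (μ := μ) hY.aemeasurable
  have := Measure.isProbabilityMeasure_map (μ := μ) hZ.aemeasurable
  have hYZ : Measurable fun w => (Y w, Z w) := by fun_prop
  have hm := (indepFun_iff_map_prod_eq_prod_map_map hY.aemeasurable hZ.aemeasurable).1 h'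
  have hF' : Measurable fun q : α × δ => ∫⁻ y, F (y, q) ∂(μ.map Y) := hF.lintegral_prod_left'
  have key : ∀ H : (β × δ) × α → ENNReal, Measurable H →
      ∫⁻ w, H ((Y w, Z w), X w) ∂μ =
        ∫⁻ w, ∫⁻ y, ∫⁻ z, H ((y, z), X w) ∂(μ.map Z) ∂(μ.map Y) ∂μ := by
    intro H hH
    rw [lintegral_comp_of_indepFun hYZ hX h.symm hH, hm]
    refine lintegral_congr fun w => ?_
    rw [lintegral_prod _ (by fun_prop)]
  -- Both sides are expanded over the product law; on the right the `Y`-variable is already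
  -- integrated out, which leaves an idle integral of mass one.
  rw [key (fun p => F (p.1.1, p.2, p.1.2)) (by fun_prop),
    key (fun p => ∫⁻ y, F (y, p.2, p.1.2) ∂(μ.map Y)) (by fun_prop)]
  refine lintegral_congr fun w => ?_
  simp only [lintegral_const, measure_univ, mul_one]
  exact lintegral_lintegral_swap (f := fun y z => F (y, X w, z)) (by fun_prop)

/-! ### Moments and tails of Gamma laws -/

/-- The mean of `φ` under the Gamma law with shape `k + 1` and unit scale. -/
noncomputable def gammaMean (k : ℕ) (φ : ℝ → ENNReal) : ENNReal :=
  ∫⁻ t in Ioi (0 : ℝ), ENNReal.ofReal (t ^ k * Real.exp (-t) / k.factorial) * φ t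

/-- Multiplication by `t` turns the density of shape `k + 1` into `k + 1` times that of shape `k +
2`. -/
lemma gammaMean_id (k : ℕ) : gammaMean k ENNReal.ofReal = ENNReal.ofReal (k + 1) := by
  have e : ∀ t ∈ Ioi (0 : ℝ), ENNReal.ofReal (t ^ k * Real.exp (-t) / k.factorial) *
      ENNReal.ofReal t = ENNReal.ofReal (k + 1) *
        ENNReal.ofReal (t ^ (k + 1) * Real.exp (-t) / (k + 1).factorial) := by
    intro t ht
    have : (0 : ℝ) < t := ht
    rw [← ENNReal.ofReal_mul (by positivity), ← ENNReal.ofReal_mul (by positivity),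
      Nat.factorial_succ]
    congr 1
    push_cast
    field_simp
    ring
  rw [gammaMean, setLIntegral_congr_fun measurableSet_Ioi e,
    lintegral_const_mul' _ _ ENNReal.ofReal_ne_top, lintegral_gamma_density, mul_one]

lemma gammaMean_sq (k : ℕ) :
    gammaMean k (fun t => ENNReal.ofReal (t ^ 2)) = ENNReal.ofReal ((k + 1) * (k + 2)) := by
  have e : ∀ t ∈ Ioi (0 : ℝ), ENNReal.ofReal (t ^ k * Real.exp (-t) / k.factorial) *
      ENNReal.ofReal (t ^ 2) = ENNReal.ofReal ((k + 1) * (k + 2)) *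
        ENNReal.ofReal (t ^ (k + 2) * Real.exp (-t) / (k + 2).factorial) := by
    intro t ht
    have : (0 : ℝ) < t := ht
    rw [← ENNReal.ofReal_mul (by positivity), ← ENNReal.ofReal_mul (by positivity),
      Nat.factorial_succ, Nat.factorial_succ]
    congr 1
    push_cast
    field_simp
    ring
  rw [gammaMean, setLIntegral_congr_fun measurableSet_Ioi e,
    lintegral_const_mul' _ _ ENNReal.ofReal_ne_top, lintegral_gamma_density, mul_one]

lemma integrableOn_pow_mul_exp_neg_Ioi (k : ℕ) {x : ℝ} (hx : 0 ≤ x) :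
    IntegrableOn (fun t => t ^ k * Real.exp (-t)) (Ioi x) := by
  have h := Real.GammaIntegral_convergent (s := (k : ℝ) + 1) (by positivity)
  refine (h.mono_set (Ioi_subset_Ioi hx)).congr_fun (fun t ht => ?_) measurableSet_Ioi
  simp [mul_comm]

/-- The tail of the Gamma law in terms of the upper incomplete Gamma function. -/
lemma gammaMean_indicator_Ioi (k : ℕ) {x : ℝ} (hx : 0 < x) (φ : ℝ → ENNReal) :
    gammaMean k ((Ioi x).indicator φ) =
      ∫⁻ t in Ioi x, ENNReal.ofReal (t ^ k * Real.exp (-t) / k.factorial) * φ t := by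
  rw [gammaMean, ← lintegral_indicator measurableSet_Ioi, ← lintegral_indicator measurableSet_Ioi]
  refine lintegral_congr fun t => ?_
  by_cases h : t ∈ Ioi x
  · have h0 : t ∈ Ioi (0 : ℝ) := hx.trans h
    simp [h, h0]
  · simp [h]

lemma upperGamma_nonneg (s : ℝ) {x : ℝ} (hx : 0 ≤ x) : 0 ≤ upperGamma s x :=
  setIntegral_nonneg measurableSet_Ioi fun _ ht =>
    mul_nonneg (Real.rpow_nonneg (hx.trans (le_of_lt ht)) _) (Real.exp_pos _).le

lemma gammaMean_tail (k : ℕ) {x : ℝ} (hx : 0 < x) :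
    gammaMean k ((Ioi x).indicator fun _ => 1) =
      ENNReal.ofReal (upperGamma (k + 1) x / k.factorial) := by
  rw [gammaMean_indicator_Ioi k hx, upperGamma, ← integral_div, ofReal_integral_eq_lintegral_ofReal]
  · refine setLIntegral_congr_fun measurableSet_Ioi fun t ht => ?_
    simp
  · refine IntegrableOn.congr_fun (f := fun t => t ^ k * Real.exp (-t) / k.factorial)
      ((integrableOn_pow_mul_exp_neg_Ioi k hx.le).div_const _) (fun t _ => ?_) measurableSet_Ioi
    simp
  · refine (ae_restrict_mem measurableSet_Ioi).mono fun t ht => ?_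
    have : (0 : ℝ) < t := hx.trans ht
    simp only [Pi.zero_apply]
    positivity

/-- The weight `1/t` lowers the exponent by one, which is how `Γ(L-2, ·)` enters `φ`. Cutting at `x
> 0` keeps the case `k = 0` finite. -/
lemma gammaMean_inv_tail (k : ℕ) {x : ℝ} (hx : 0 < x) {a : ℝ} (ha : 0 ≤ a) :
    gammaMean k ((Ioi x).indicator fun t => ENNReal.ofReal (a / t)) =
      ENNReal.ofReal (a * (upperGamma k x / k.factorial)) := by
  have e : ∀ t ∈ Ioi x, a * (t ^ ((k : ℝ) - 1) * Real.exp (-t) / k.factorial) =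
      t ^ k * Real.exp (-t) / k.factorial * (a / t) := by
    intro t ht
    have ht : 0 < t := hx.trans ht
    rw [Real.rpow_sub ht, Real.rpow_one, Real.rpow_natCast]
    field_simp
  rw [gammaMean_indicator_Ioi k hx, upperGamma, ← integral_div, ← integral_const_mul,
    setIntegral_congr_fun measurableSet_Ioi e, ofReal_integral_eq_lintegral_ofReal]
  · refine setLIntegral_congr_fun measurableSet_Ioi fun t ht => ?_
    have : (0 : ℝ) < t := hx.trans ht
    rw [← ENNReal.ofReal_mul (by positivity)]
  · refine Integrable.mono' (g := fun t => t ^ k * Real.exp (-t) / k.factorial * (a / x))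
      (((integrableOn_pow_mul_exp_neg_Ioi k hx.le).div_const _).mul_const _)
      (by fun_prop) ?_
    refine (ae_restrict_mem measurableSet_Ioi).mono fun t ht => ?_
    have ht' : x < t := ht
    have : (0 : ℝ) < t := hx.trans ht
    rw [Real.norm_of_nonneg (by positivity)]
    gcongr
  · refine (ae_restrict_mem measurableSet_Ioi).mono fun t ht => ?_
    have : (0 : ℝ) < t := hx.trans ht
    simp only [Pi.zero_apply]
    positivity

/-! ### Joint moments of `g_x`, `ε`, `δ` and the projected power -/

lemma measurable_channelShape {L : ℕ} : Measurable (channelShape (L := L)) := by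
  unfold channelShape
  exact Measurable.smul (Complex.measurable_ofReal.comp measurable_norm).inv measurable_id

lemma measurable_perp {L : ℕ} : Measurable (Function.uncurry (perp (E := EuclideanSpace ℂ (Fin L)))) := by
  unfold perp Function.uncurry
  fun_prop

namespace CognitiveLink

variable {k : ℕ} {c : LinkParams} {B : ℕ} {Ω : Type*} [MeasurableSpace Ω] {μ : Measure Ω}
  (S : CognitiveLink (k + 2) c B μ)

/-- The quantized direction as a function of the channel and the seed. -/
noncomputable def sxHatFun (x : EuclideanSpace ℂ (Fin (k + 2)) × ℝ) :
    EuclideanSpace ℂ (Fin (k + 2)) :=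
  S.quantizer (channelShape x.1) x.2

lemma measurable_sxHatFun : Measurable S.sxHatFun :=
  S.measurable_quantizer.comp
    ((measurable_channelShape.comp measurable_fst).prodMk measurable_snd)

/-- The power `‖P h_s‖²` of the secondary channel in the complement of the quantized direction. -/
noncomputable def projPower (w : Ω) : ℝ := ‖perp (S.sxHat w) (S.hs w)‖ ^ 2

lemma norm_sx {w : Ω} (hw : S.hx w ≠ 0) : ‖S.sx w‖ = 1 := norm_channelShape hw

lemma norm_sxHat {w : Ω} (hw : S.hx w ≠ 0) : ‖S.sxHat w‖ = 1 :=
  S.norm_quantizer _ _ (S.norm_sx hw)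

lemma epsilon_eq {w : Ω} (hw : S.hx w ≠ 0) : S.epsilon w = ‖perp (S.sxHat w) (S.sx w)‖ ^ 2 := by
  rw [norm_perp_sq (S.norm_sxHat hw), S.norm_sx hw, epsilon, one_pow]

lemma epsilon_nonneg {w : Ω} (hw : S.hx w ≠ 0) : 0 ≤ S.epsilon w := by
  rw [S.epsilon_eq hw]; positivity

lemma gx_nonneg (w : Ω) : 0 ≤ S.gx w := by unfold gx; positivity

lemma gx_pos {w : Ω} (hw : S.hx w ≠ 0) : 0 < S.gx w :=
  div_pos (pow_pos (norm_pos_iff.2 hw) 2) (by exact_mod_cast c.pathGain_pos)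

lemma delta_nonneg (w : Ω) : 0 ≤ S.delta w := by unfold delta; positivity

/-- The randomness that is independent of the primary channel. -/
def rest (w : Ω) : EuclideanSpace ℂ (Fin (k + 2)) × EuclideanSpace ℂ (Fin (k + 2)) × ℝ :=
  (S.hs w, S.hx w, S.seed w)

lemma measurable_rest : Measurable S.rest :=
  S.measurable_hs.prodMk (S.measurable_hx.prodMk S.measurable_seed)

/-- `δ` as a function of the channels and the seed. -/
noncomputable def deltaFun (r : EuclideanSpace ℂ (Fin (k + 2)) ×
    EuclideanSpace ℂ (Fin (k + 2)) × ℝ) : ℝ :=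
  ‖inner ℂ (channelShape r.2.1)
    (channelShape (perp (S.sxHatFun r.2) (channelShape r.1)))‖ ^ 2

/-- `‖P h_s‖²` as a function of the channels and the seed. -/
noncomputable def projPowerFun (r : EuclideanSpace ℂ (Fin (k + 2)) ×
    EuclideanSpace ℂ (Fin (k + 2)) × ℝ) : ℝ :=
  ‖perp (S.sxHatFun r.2) r.1‖ ^ 2

lemma delta_eq (w : Ω) : S.delta w = S.deltaFun (S.rest w) := rfl

lemma projPower_eq (w : Ω) : S.projPower w = S.projPowerFun (S.rest w) := rfl

lemma measurable_deltaFun : Measurable S.deltaFun := by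
  have h1 : Measurable fun r : EuclideanSpace ℂ (Fin (k + 2)) ×
      EuclideanSpace ℂ (Fin (k + 2)) × ℝ => channelShape r.2.1 :=
    measurable_channelShape.comp (measurable_fst.comp measurable_snd)
  have h2 : Measurable fun r : EuclideanSpace ℂ (Fin (k + 2)) ×
      EuclideanSpace ℂ (Fin (k + 2)) × ℝ =>
        channelShape (perp (S.sxHatFun r.2) (channelShape r.1)) :=
    measurable_channelShape.comp (measurable_perp.comp
      ((S.measurable_sxHatFun.comp measurable_snd).prodMk
        (measurable_channelShape.comp measurable_fst)))
  unfold deltaFun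
  fun_prop

lemma measurable_projPowerFun : Measurable S.projPowerFun :=
  ((measurable_perp.comp ((S.measurable_sxHatFun.comp measurable_snd).prodMk
    measurable_fst)).norm).pow_const 2

lemma measurable_gx : Measurable S.gx := by
  have := S.measurable_hx
  unfold gx
  fun_prop

lemma measurable_sx : Measurable S.sx := measurable_channelShape.comp S.measurable_hx

lemma measurable_sxHat : Measurable S.sxHat := by
  have h : Measurable fun w => S.sxHatFun (S.hx w, S.seed w) :=
    Measurable.comp (g := S.sxHatFun) S.measurable_sxHatFun
      (S.measurable_hx.prodMk S.measurable_seed)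
  exact h

lemma measurable_epsilon : Measurable S.epsilon := by
  have h1 := S.measurable_sx
  have h2 := S.measurable_sxHat
  unfold epsilon
  fun_prop

variable [IsProbabilityMeasure μ]

lemma map_hx : μ.map S.hx = isoGaussian _ c.pathGain :=
  map_eq_isoGaussian c.pathGain_pos S.measurable_hx S.law_hx S.indep_hx

lemma map_hs : μ.map S.hs = isoGaussian _ 1 := by
  simpa using map_eq_isoGaussian one_pos S.measurable_hs S.law_hs S.indep_hs

lemma ae_hx_ne_zero : ∀ᵐ w ∂μ, S.hx w ≠ 0 := by
  have : ∀ᵐ x ∂(μ.map S.hx), x ≠ 0 := by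
    rw [S.map_hx, ae_iff]
    simpa using isoGaussian_singleton (k := k + 1) (v := c.pathGain) 0
  exact ae_of_ae_map S.measurable_hx.aemeasurable this

lemma lintegral_comp_hs {F : EuclideanSpace ℂ (Fin (k + 2)) ×
    EuclideanSpace ℂ (Fin (k + 2)) × ℝ → ENNReal} (hF : Measurable F) :
    ∫⁻ w, F (S.hs w, S.hx w, S.seed w) ∂μ =
      ∫⁻ w, ∫⁻ h, F (h, S.hx w, S.seed w) ∂(isoGaussian _ 1) ∂μ := by
  rw [lintegral_comp_of_indepFun_of_indepFun S.measurable_hx S.measurable_hs S.measurable_seed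
    S.indep_hx_rest S.indep_hs_seed hF, S.map_hs]

/-- The mean of `g_x δ` weighted by a function of `‖P h_s‖²`. -/
lemma lintegral_gx_delta {φ : ℝ → ENNReal} (hφ : Measurable φ) :
    ∫⁻ w, ENNReal.ofReal (S.gx w * S.delta w) * φ (S.projPower w) ∂μ =
      (∫⁻ w, ENNReal.ofReal (S.gx w * S.epsilon w) ∂μ) *
        (ENNReal.ofReal (1 / (k + 1 : ℝ)) * gammaMean k φ) := by
  have hd := S.measurable_deltaFun
  have hp := S.measurable_projPowerFun
  have h := S.lintegral_comp_hs (F := fun r => ENNReal.ofReal (‖r.2.1‖ ^ 2 / c.pathGain *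
    S.deltaFun r) * φ (S.projPowerFun r)) (by fun_prop)
  refine h.trans ?_
  have hm : Measurable fun w => ENNReal.ofReal (S.gx w * S.epsilon w) := by
    have h1 := S.measurable_gx
    have h2 := S.measurable_epsilon
    fun_prop
  rw [← lintegral_mul_const _ hm]
  refine lintegral_congr_ae ?_
  filter_upwards [S.ae_hx_ne_zero] with w hw
  -- With `h_x` and the seed frozen, `ŝ_x` and `s_x` are fixed unit vectors, and `ε` is the squared
  -- norm of the projection of `s_x`.
  have h2 := lintegral_inner_perp (S.norm_sxHat hw) (S.sx w) hφ
  rw [← S.epsilon_eq hw] at h2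
  calc _ = ∫⁻ h, ENNReal.ofReal (S.gx w) * (ENNReal.ofReal (‖inner ℂ (S.sx w)
        (channelShape (perp (S.sxHat w) (channelShape h)))‖ ^ 2) *
          φ (‖perp (S.sxHat w) h‖ ^ 2)) ∂(isoGaussian _ 1) := by
        refine lintegral_congr fun h => ?_
        rw [← mul_assoc, ← ENNReal.ofReal_mul (S.gx_nonneg w)]
        rfl
    _ = _ := by
        rw [lintegral_const_mul' _ _ ENNReal.ofReal_ne_top, h2, ← mul_assoc, ← mul_assoc,
          ← ENNReal.ofReal_mul (S.gx_nonneg w),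
          ← ENNReal.ofReal_mul (mul_nonneg (S.gx_nonneg w) (S.epsilon_nonneg hw)), gammaMean]
        congr 2
        ring

lemma lintegral_projPower {φ : ℝ → ENNReal} (hφ : Measurable φ) :
    ∫⁻ w, φ (S.projPower w) ∂μ = gammaMean k φ := by
  have hp := S.measurable_projPowerFun
  have h := S.lintegral_comp_hs (F := fun r => φ (S.projPowerFun r)) (by fun_prop)
  refine h.trans ?_
  rw [← mul_one (gammaMean k φ), ← measure_univ (μ := μ), ← lintegral_const]
  refine lintegral_congr_ae ?_
  filter_upwards [S.ae_hx_ne_zero] with w hw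
  exact lintegral_norm_perp (S.norm_sxHat hw) hφ

/-- Norm and quantization error of the channel to the primary receiver are independent. -/
lemma lintegral_gx_epsilon :
    ∫⁻ w, ENNReal.ofReal (S.gx w * S.epsilon w) ∂μ =
      ENNReal.ofReal (k + 2) * ∫⁻ w, ENNReal.ofReal (S.epsilon w) ∂μ := by
  have hl : (0 : ℝ) < c.pathGain := by exact_mod_cast c.pathGain_pos
  have hind : IndepFun S.hx S.seed μ := S.indep_hx_rest.comp measurable_id measurable_snd
  have hq : Measurable fun p : EuclideanSpace ℂ (Fin (k + 2)) × ℝ =>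
      S.quantizer (‖p.1‖⁻¹ • p.1) p.2 :=
    S.measurable_quantizer.comp (Measurable.prodMk (by fun_prop) (by fun_prop))
  have hq' : ∀ u, Measurable fun y => S.quantizer y u := fun u =>
    S.measurable_quantizer.comp (Measurable.prodMk measurable_id measurable_const)
  have hcs : ∀ x : EuclideanSpace ℂ (Fin (k + 2)), channelShape x = ‖x‖⁻¹ • x := by
    intro x
    rw [channelShape, ← Complex.ofReal_inv, Complex.coe_smul]
  -- For a fixed seed, `ε` is a function of the direction of `h_x` alone, so the polar decomposition
  -- separates it from the norm.
  have key : ∀ φ : ℝ → ENNReal, Measurable φ →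
      ∫⁻ w, φ (‖S.hx w‖ ^ 2) * ENNReal.ofReal (S.epsilon w) ∂μ =
      (∫⁻ w, ∫⁻ x, ENNReal.ofReal (1 - ‖inner ℂ (S.quantizer (‖x‖⁻¹ • x) (S.seed w))
        (‖x‖⁻¹ • x)‖ ^ 2) ∂(isoGaussian _ c.pathGain) ∂μ) *
        gammaMean (k + 1) (fun t => φ (c.pathGain * t)) := by
    intro φ hφ
    have h := lintegral_comp_of_indepFun S.measurable_hx S.measurable_seed hind
      (F := fun p => φ (‖p.1‖ ^ 2) * ENNReal.ofReal (1 - ‖inner ℂ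
        (S.quantizer (‖p.1‖⁻¹ • p.1) p.2) (‖p.1‖⁻¹ • p.1)‖ ^ 2)) (by fun_prop)
    have e : ∀ w, φ (‖S.hx w‖ ^ 2) * ENNReal.ofReal (S.epsilon w) =
        φ (‖S.hx w‖ ^ 2) * ENNReal.ofReal (1 - ‖inner ℂ
        (S.quantizer (‖S.hx w‖⁻¹ • S.hx w) (S.seed w)) (‖S.hx w‖⁻¹ • S.hx w)‖ ^ 2) := by
      intro w
      rw [epsilon, sxHat, sx, hcs]
    simp_rw [e]
    rw [h, S.map_hx, ← lintegral_mul_const]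
    · refine lintegral_congr fun w => ?_
      have := hq' (S.seed w)
      exact isoGaussian_radial (finrank_real_euclideanSpace_complex (k + 2)) hl hφ
        (ψ := fun y => ENNReal.ofReal (1 - ‖inner ℂ (S.quantizer y (S.seed w)) y‖ ^ 2))
        (by fun_prop)
    · have := isProbabilityMeasure_isoGaussian (V := EuclideanSpace ℂ (Fin (k + 2))) hl
      have hm : Measurable fun u => ∫⁻ x, ENNReal.ofReal (1 - ‖inner ℂ
          (S.quantizer (‖x‖⁻¹ • x) u) (‖x‖⁻¹ • x)‖ ^ 2) ∂(isoGaussian _ c.pathGain) :=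
        Measurable.lintegral_prod_left' (f := fun p :
          EuclideanSpace ℂ (Fin (k + 2)) × ℝ => ENNReal.ofReal (1 - ‖inner ℂ
          (S.quantizer (‖p.1‖⁻¹ • p.1) p.2) (‖p.1‖⁻¹ • p.1)‖ ^ 2)) (by fun_prop)
      exact hm.comp S.measurable_seed
  -- Comparing the weights `1` and `t/λ` eliminates the common directional integral.
  have k1 := key (fun _ => 1) measurable_const
  have k2 := key (fun t => ENNReal.ofReal (t / c.pathGain)) (by fun_prop)
  have g1 : gammaMean (k + 1) (fun _ => 1) = 1 := by
    simpa [gammaMean] using lintegral_gamma_density (k + 1)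
  have g2 : gammaMean (k + 1) (fun t => ENNReal.ofReal (c.pathGain * t / c.pathGain)) =
      ENNReal.ofReal (k + 2) := by
    have : ∀ t : ℝ, c.pathGain * t / c.pathGain = t := fun t => by field_simp
    simp_rw [this]
    refine (gammaMean_id (k + 1)).trans ?_
    push_cast
    ring_nf
  rw [g1, mul_one] at k1
  simp only [one_mul] at k1
  rw [g2, ← k1, mul_comm] at k2
  rw [← k2]
  refine lintegral_congr fun w => ?_
  rw [← ENNReal.ofReal_mul (by positivity)]
  rfl

lemma lintegral_gx_sq :
    ∫⁻ w, ENNReal.ofReal (S.gx w ^ 2) ∂μ = ENNReal.ofReal ((k + 2) * (k + 3)) := by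
  have hl : (0 : ℝ) < c.pathGain := by exact_mod_cast c.pathGain_pos
  have h := lintegral_norm_sq_isoGaussian (finrank_real_euclideanSpace_complex (k + 2)) hl
    (φ := fun t => ENNReal.ofReal ((t / c.pathGain) ^ 2)) (by fun_prop)
  rw [← S.map_hx, lintegral_map (by fun_prop) S.measurable_hx] at h
  refine h.trans ?_
  have : ∀ t : ℝ, c.pathGain * t / c.pathGain = t := fun t => by field_simp
  simp_rw [this]
  refine (gammaMean_sq (k + 1)).trans ?_
  push_cast
  ring_nf

end CognitiveLink

/-! ### Exponential law of the primary channel power -/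

lemma gammaMean_zero_indicator {s : Set ℝ} (hs : MeasurableSet s) (h : s ⊆ Ioi 0) :
    gammaMean 0 (s.indicator fun _ => 1) = ∫⁻ t in s, ENNReal.ofReal (Real.exp (-t)) := by
  rw [gammaMean, ← lintegral_indicator measurableSet_Ioi, ← lintegral_indicator hs]
  refine lintegral_congr fun t => ?_
  by_cases ht : t ∈ s
  · simp [ht, h ht, -mem_Ioi]
  · simp [ht]

lemma gammaMean_zero_Ici {a : ℝ} (ha : 0 < a) :
    gammaMean 0 ((Ici a).indicator fun _ => 1) = ENNReal.ofReal (Real.exp (-a)) := by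
  rw [gammaMean_zero_indicator measurableSet_Ici (fun t ht => ha.trans_le ht),
    setLIntegral_congr Ioi_ae_eq_Ici.symm, ← integral_exp_neg_Ioi a,
    ofReal_integral_eq_lintegral_ofReal (integrableOn_exp_neg_Ioi a)
      (Filter.Eventually.of_forall fun t => (Real.exp_pos _).le)]

lemma gammaMean_zero_Ioc {a : ℝ} (ha : 0 < a) (b : ℝ) :
    gammaMean 0 ((Ioc a b).indicator fun _ => 1) =
      ENNReal.ofReal (Real.exp (-a) - Real.exp (-b)) := by
  rcases le_total a b with hab | hab
  · rw [gammaMean_zero_indicator measurableSet_Ioc (fun t ht => ha.trans ht.1),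
      ← ofReal_integral_eq_lintegral_ofReal
      ((integrableOn_exp_neg_Ioi a).mono_set Ioc_subset_Ioi_self)
      (Filter.Eventually.of_forall fun t => (Real.exp_pos _).le),
      ← intervalIntegral.integral_of_le hab, intervalIntegral.integral_comp_neg Real.exp,
      integral_exp]
  -- For `b ≤ a` the difference of exponentials is nonpositive and `ENNReal.ofReal` truncates it to
  -- the measure of the empty set.
  · rw [Ioc_eq_empty hab.not_gt, ENNReal.ofReal_of_nonpos]
    · simp [gammaMean]
    · have := Real.exp_le_exp.2 (neg_le_neg hab)
      linarith

lemma gammaMean_zero_Icc {a : ℝ} (ha : 0 < a) (b : ℝ) :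
    gammaMean 0 ((Icc a b).indicator fun _ => 1) =
      ENNReal.ofReal (Real.exp (-a) - Real.exp (-b)) := by
  rw [← gammaMean_zero_Ioc ha b,
    gammaMean_zero_indicator measurableSet_Ioc (fun t ht => ha.trans ht.1),
    gammaMean_zero_indicator measurableSet_Icc (fun t ht => ha.trans_le ht.1),
    setLIntegral_congr Ioc_ae_eq_Icc]

lemma complexGaussian_norm_sq {s : Set ℝ} (hs : MeasurableSet s) :
    complexGaussian 1 {z | ‖z‖ ^ 2 ∈ s} = gammaMean 0 (s.indicator fun _ => 1) := by
  have h := lintegral_norm_sq_isoGaussian (V := ℂ) (k := 0) (v := 1) (by simp) one_pos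
    (φ := s.indicator fun _ => 1) (measurable_const.indicator hs)
  simp only [one_mul] at h
  rw [gammaMean, ← h, complexGaussian_eq_isoGaussian one_pos, NNReal.coe_one]
  exact (lintegral_indicator_one
    (hs.preimage (by fun_prop : Measurable fun z : ℂ => ‖z‖ ^ 2))).symm

/-! ### Law of the quantization error and the resulting means -/

/-- The size `2^(-B/(k+1))` of the cells of the `B`-bit quantizer in dimension `k + 2`. -/
noncomputable def cdiBound (k B : ℕ) : ℝ := 2 ^ (-((B : ℝ) / (k + 1)))

lemma cdiBound_pos (k B : ℕ) : 0 < cdiBound k B := by unfold cdiBound; positivity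

lemma two_pow_mul_cdiBound_pow (k B : ℕ) : 2 ^ B * cdiBound k B ^ (k + 1) = 1 := by
  rw [cdiBound, ← Real.rpow_natCast (2 ^ _), ← Real.rpow_mul (by norm_num), ← Real.rpow_natCast,
    ← Real.rpow_add (by norm_num)]
  have : (B : ℝ) + -((B : ℝ) / (k + 1)) * ((k + 1 : ℕ) : ℝ) = 0 := by
    push_cast
    field_simp
    ring
  rw [this, Real.rpow_zero]

namespace CognitiveLink

variable {k : ℕ} {c : LinkParams} {B : ℕ} {Ω : Type*} [MeasurableSpace Ω] {μ : Measure Ω}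
  (S : CognitiveLink (k + 2) c B μ)

lemma cdf_epsilon {τ : ℝ} (h0 : 0 ≤ τ) (h1 : τ ≤ cdiBound k B) :
    μ.real {w | S.epsilon w ≤ τ} = 2 ^ B * τ ^ (k + 1) := by
  refine S.cdf_error τ h0 (h1.trans_eq ?_)
  rw [cdiBound]
  congr 3
  push_cast
  ring

lemma indepFun_hp_rest : IndepFun S.hp S.rest μ :=
  S.indep_hp_rest.comp (φ := id) (ψ := fun r : EuclideanSpace ℂ (Fin (k + 2)) ×
    EuclideanSpace ℂ (Fin (k + 2)) × ℝ => (r.2.1, r.1, r.2.2)) measurable_id (by fun_prop)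

variable [IsProbabilityMeasure μ]

lemma ae_epsilon_le : ∀ᵐ w ∂μ, S.epsilon w ≤ cdiBound k B := by
  have h := S.cdf_epsilon (cdiBound_pos k B).le le_rfl
  rw [two_pow_mul_cdiBound_pow] at h
  have hm : MeasurableSet {w | S.epsilon w ≤ cdiBound k B} :=
    measurableSet_le S.measurable_epsilon measurable_const
  have h' : μ {w | S.epsilon w ≤ cdiBound k B} = 1 := by
    rwa [measureReal_def, ENNReal.toReal_eq_one_iff] at h
  exact (mem_ae_iff_prob_eq_one hm).2 h'

/-- Where `ε = 0`, the quotient in `eta` is `0` by the convention on division rather than infinite;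
the distribution function at `τ = 0` shows that this is a null event. -/
lemma ae_epsilon_ne_zero : ∀ᵐ w ∂μ, S.epsilon w ≠ 0 := by
  have h := S.cdf_epsilon le_rfl (cdiBound_pos k B).le
  rw [zero_pow (by omega), mul_zero, measureReal_eq_zero_iff] at h
  rw [ae_iff]
  refine measure_mono_null (fun w hw => ?_) h
  simp only [ne_eq, not_not, mem_ofPred_eq] at hw
  simp [hw]

/-- The mean quantization error. -/
lemma lintegral_epsilon :
    ∫⁻ w, ENNReal.ofReal (S.epsilon w) ∂μ =
      ENNReal.ofReal (cdiBound k B * (k + 1) / (k + 2)) := by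
  have hD := cdiBound_pos k B
  have hnn : 0 ≤ᵐ[μ] S.epsilon := by
    filter_upwards [S.ae_hx_ne_zero] with w hw using S.epsilon_nonneg hw
  rw [lintegral_eq_lintegral_meas_lt μ hnn S.measurable_epsilon.aemeasurable]
  -- Layer-cake formula: the tail is `1 - 2^B t^(k+1)` up to `cdiBound k B` and zero beyond.
  have h1 : ∀ t ∈ Ioi (0 : ℝ), μ {w | t < S.epsilon w} =
      (Ioc 0 (cdiBound k B)).indicator
        (fun t => ENNReal.ofReal (1 - 2 ^ B * t ^ (k + 1))) t := by
    intro t ht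
    have ht0 : (0 : ℝ) < t := ht
    by_cases htD : t ≤ cdiBound k B
    · rw [indicator_of_mem (mem_Ioc.2 ⟨ht0, htD⟩), ← S.cdf_epsilon ht0.le htD]
      have hm : MeasurableSet {w | S.epsilon w ≤ t} :=
        measurableSet_le S.measurable_epsilon measurable_const
      rw [← probReal_compl_eq_one_sub hm, ofReal_measureReal]
      congr 1
      ext w
      simp
    · rw [indicator_of_notMem (fun h => htD h.2)]
      refine measure_mono_null (fun w hw => ?_) (ae_iff.1 S.ae_epsilon_le)
      have hw : t < S.epsilon w := hw
      exact not_le.2 ((not_le.1 htD).trans hw)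
  have hint : ∫ t in Ioc 0 (cdiBound k B), (1 - 2 ^ B * t ^ (k + 1)) =
      cdiBound k B * (k + 1) / (k + 2) := by
    rw [← intervalIntegral.integral_of_le hD.le, intervalIntegral.integral_sub
      (by simp) (Continuous.intervalIntegrable (by fun_prop) _ _),
      intervalIntegral.integral_const_mul, integral_pow]
    have := two_pow_mul_cdiBound_pow k B
    simp only [intervalIntegral.integral_const, sub_zero, smul_eq_mul, mul_one]
    rw [zero_pow (by omega), sub_zero, pow_succ _ (k + 1), mul_div_assoc', ← mul_assoc, this]
    push_cast
    field_simp
    ring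
  rw [setLIntegral_congr_fun measurableSet_Ioi h1, setLIntegral_indicator measurableSet_Ioc,
    inter_eq_left.2 (fun t ht => ht.1), ← hint, ofReal_integral_eq_lintegral_ofReal]
  · exact (Continuous.integrableOn_Icc (by fun_prop)).mono_set Ioc_subset_Icc_self
  · refine (ae_restrict_mem measurableSet_Ioc).mono fun t ht => ?_
    simp only [Pi.zero_apply, sub_nonneg]
    rw [← two_pow_mul_cdiBound_pow k B]
    have := ht.1.le
    gcongr
    exact ht.2

lemma lintegral_gx_epsilon_eq :
    ∫⁻ w, ENNReal.ofReal (S.gx w * S.epsilon w) ∂μ = ENNReal.ofReal ((k + 1) * cdiBound k B) := by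
  rw [S.lintegral_gx_epsilon, S.lintegral_epsilon, ← ENNReal.ofReal_mul (by positivity)]
  congr 1
  field_simp

/-- The mean fraction `1/(k+1)` from the random direction of `h_s` cancels the factor `k + 1` in the
mean of `g_x ε`. Conditionally on the projected power, `g_x δ` thus has constant mean, `k + 1` times
smaller than that of `g_x ε`. -/
lemma lintegral_gx_delta_eq {φ : ℝ → ENNReal} (hφ : Measurable φ) :
    ∫⁻ w, ENNReal.ofReal (S.gx w * S.delta w) * φ (S.projPower w) ∂μ =
      ENNReal.ofReal (cdiBound k B) * gammaMean k φ := by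
  have := cdiBound_pos k B
  rw [S.lintegral_gx_delta hφ, S.lintegral_gx_epsilon_eq, ← mul_assoc,
    ← ENNReal.ofReal_mul (by positivity)]
  congr 2
  field_simp

lemma lintegral_gx_epsilon_sq_le :
    ∫⁻ w, ENNReal.ofReal ((S.gx w * S.epsilon w) ^ 2) ∂μ ≤
      ENNReal.ofReal ((k + 2) * (k + 3) * cdiBound k B ^ 2) := by
  rw [ENNReal.ofReal_mul (by positivity), ← S.lintegral_gx_sq,
    ← lintegral_mul_const' _ _ ENNReal.ofReal_ne_top]
  refine lintegral_mono_ae ?_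
  filter_upwards [S.ae_hx_ne_zero, S.ae_epsilon_le] with w hw hw'
  rw [← ENNReal.ofReal_mul (by positivity), mul_pow]
  have := S.epsilon_nonneg hw
  gcongr

/-- Once `ε ≠ 0`, the projection of `s_x` is nonzero, and an isotropic vector is almost surely not
orthogonal to it. -/
lemma ae_delta_ne_zero : ∀ᵐ w ∂μ, S.delta w ≠ 0 := by
  have hs : MeasurableSet {r | S.deltaFun r = 0} := S.measurable_deltaFun (measurableSet_singleton 0)
  have h := S.lintegral_comp_hs (F := {r | S.deltaFun r = 0}.indicator 1)
    (measurable_const.indicator hs)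
  have h1 : ∫⁻ w, {r | S.deltaFun r = 0}.indicator 1 (S.rest w) ∂μ = μ {w | S.delta w = 0} :=
    lintegral_indicator_one (hs.preimage S.measurable_rest)
  have h2 : ∀ᵐ w ∂μ, ∫⁻ h, {r | S.deltaFun r = 0}.indicator 1 (h, S.hx w, S.seed w)
      ∂(isoGaussian (EuclideanSpace ℂ (Fin (k + 2))) 1) = (0 : ENNReal) := by
    filter_upwards [S.ae_hx_ne_zero, S.ae_epsilon_ne_zero] with w hw hw'
    rw [S.epsilon_eq hw] at hw'
    have hp : perp (S.sxHat w) (S.sx w) ≠ 0 := fun h => hw' (by simp [h])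
    rw [← lintegral_zero (μ := isoGaussian (EuclideanSpace ℂ (Fin (k + 2))) 1)]
    refine lintegral_congr_ae ?_
    filter_upwards [ae_inner_channelShape_perp_ne_zero (S.norm_sxHat hw) hp] with h hh
    have e : S.deltaFun (h, S.hx w, S.seed w) =
        ‖inner ℂ (S.sx w) (channelShape (perp (S.sxHat w) (channelShape h)))‖ ^ 2 := rfl
    rw [← e] at hh
    simp [hh]
  rw [ae_iff]
  simp only [ne_eq, not_not]
  rw [← h1]
  refine h.trans ?_
  rw [lintegral_congr_ae h2, lintegral_zero]

/-- By independence all other randomness can be frozen, leaving the unit exponential law (`gammaMean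
0`) of `g_p`. -/
lemma measure_gp_mem {T : Set (ℝ × EuclideanSpace ℂ (Fin (k + 2)) ×
    EuclideanSpace ℂ (Fin (k + 2)) × ℝ)} (hT : MeasurableSet T) :
    μ {w | (S.gp w, S.rest w) ∈ T} =
      ∫⁻ w, gammaMean 0 ({t | (t, S.rest w) ∈ T}.indicator fun _ => 1) ∂μ := by
  set s := {p : ℂ × EuclideanSpace ℂ (Fin (k + 2)) ×
      EuclideanSpace ℂ (Fin (k + 2)) × ℝ | (‖p.1‖ ^ 2, p.2) ∈ T}
  have hm : MeasurableSet s := hT.preimage (by fun_prop)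
  have hgp : Measurable fun w => (S.hp w, S.rest w) :=
    S.measurable_hp.prodMk S.measurable_rest
  refine (lintegral_indicator_one (hm.preimage hgp)).symm.trans ?_
  refine (lintegral_comp_of_indepFun S.measurable_hp S.measurable_rest S.indepFun_hp_rest
    (F := s.indicator 1) (measurable_const.indicator hm)).trans ?_
  refine lintegral_congr fun w => ?_
  have hs : MeasurableSet {t : ℝ | (t, S.rest w) ∈ T} := hT.preimage (by fun_prop)
  rw [S.law_hp, ← complexGaussian_norm_sq hs]
  exact lintegral_indicator_one
    (hs.preimage (by fun_prop : Measurable fun z : ℂ => ‖z‖ ^ 2))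

end CognitiveLink

/-! ### Interval probabilities of the interference margin and their linearization -/

lemma exp_neg_sub_exp_neg_le {s t : ℝ} (hs : 0 ≤ s) (hst : s ≤ t) :
    Real.exp (-s) - Real.exp (-t) ≤ t - s := by
  have h1 : Real.exp (-t) = Real.exp (-s) * Real.exp (-(t - s)) := by
    rw [← Real.exp_add]; ring_nf
  have h2 := Real.add_one_le_exp (-(t - s))
  have h3 : Real.exp (-s) ≤ 1 := Real.exp_le_one_iff.2 (by linarith)
  have h4 := Real.exp_pos (-s)
  rw [h1]
  nlinarith

/-- Convexity gives `e^(-s) - e^(-t) ≥ e^(-t)(t - s) ≥ (1 - t)(t - s)`, and `t(t - s) ≤ t²`. -/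
lemma sub_le_exp_neg_sub_exp_neg {s t : ℝ} (hs : 0 ≤ s) (hst : s ≤ t) :
    t - s ≤ Real.exp (-s) - Real.exp (-t) + t ^ 2 := by
  have h1 : Real.exp (-s) = Real.exp (-t) * Real.exp (t - s) := by
    rw [← Real.exp_add]; ring_nf
  have h2 := Real.add_one_le_exp (t - s)
  have h3 := Real.add_one_le_exp (-t)
  have h4 := Real.exp_pos (-t)
  rw [h1]
  nlinarith

namespace LinkParams

variable (c : LinkParams)

lemma gammaP_pos : 0 < c.gammaP := div_pos c.powerPU_pos c.noise_pos

lemma gammaMax_pos : 0 < c.gammaMax := div_pos c.powerMax_pos c.noise_pos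

/-- The primary channel power below which the primary link is in outage. -/
noncomputable def gpMin : ℝ := c.thetaP / c.gammaP

lemma gpMin_pos : 0 < c.gpMin := div_pos c.thetaP_pos c.gammaP_pos

/-- The rate of the exponential law of the interference margin, given that it is nonnegative. -/
noncomputable def marginRate : ℝ := c.gpMin / c.noise

lemma marginRate_pos : 0 < c.marginRate := div_pos c.gpMin_pos c.noise_pos

end LinkParams

namespace CognitiveLink

section

variable {L : ℕ} {c : LinkParams} {B : ℕ} {Ω : Type*} [MeasurableSpace Ω] {μ : Measure Ω}
  (S : CognitiveLink L c B μ)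

lemma gp_eq (w : Ω) : S.gp w = c.gpMin + c.marginRate * S.margin w := by
  have := c.gammaP_pos
  have := c.noise_pos
  have := c.thetaP_pos
  unfold margin LinkParams.marginRate LinkParams.gpMin
  field_simp
  ring

lemma margin_nonneg_iff (w : Ω) : 0 ≤ S.margin w ↔ c.thetaP ≤ c.gammaP * S.gp w := by
  rw [margin, mul_nonneg_iff_of_pos_left c.noise_pos, sub_nonneg, one_le_div c.thetaP_pos]

end

variable {k : ℕ} {c : LinkParams} {B : ℕ} {Ω : Type*} [MeasurableSpace Ω] {μ : Measure Ω}
  (S : CognitiveLink (k + 2) c B μ)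

/-- `g_x` as a function of the channels and the seed. -/
noncomputable def gxFun (_ : CognitiveLink (k + 2) c B μ) (r : EuclideanSpace ℂ (Fin (k + 2)) ×
    EuclideanSpace ℂ (Fin (k + 2)) × ℝ) : ℝ :=
  ‖r.2.1‖ ^ 2 / c.pathGain

/-- `ε` as a function of the channels and the seed. -/
noncomputable def epsilonFun (r : EuclideanSpace ℂ (Fin (k + 2)) ×
    EuclideanSpace ℂ (Fin (k + 2)) × ℝ) : ℝ :=
  1 - ‖inner ℂ (S.sxHatFun r.2) (channelShape r.2.1)‖ ^ 2

lemma measurable_gxFun : Measurable S.gxFun := by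
  unfold gxFun
  fun_prop

lemma measurable_epsilonFun : Measurable S.epsilonFun := by
  have h1 : Measurable fun r : EuclideanSpace ℂ (Fin (k + 2)) ×
      EuclideanSpace ℂ (Fin (k + 2)) × ℝ => channelShape r.2.1 :=
    measurable_channelShape.comp (measurable_fst.comp measurable_snd)
  have h2 := S.measurable_sxHatFun
  unfold epsilonFun
  fun_prop

lemma measurable_projPower : Measurable S.projPower := by
  have h : Measurable fun w => S.projPowerFun (S.rest w) :=
    S.measurable_projPowerFun.comp S.measurable_rest
  exact h

lemma gx_eq (w : Ω) : S.gx w = S.gxFun (S.rest w) := rfl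

lemma epsilon_eq_fun (w : Ω) : S.epsilon w = S.epsilonFun (S.rest w) := rfl

lemma gxFun_nonneg (r) : 0 ≤ S.gxFun r := by unfold gxFun; positivity

lemma deltaFun_nonneg (r) : 0 ≤ S.deltaFun r := by unfold deltaFun; positivity

variable [IsProbabilityMeasure μ]

lemma measure_margin_nonneg :
    μ {w | c.thetaP ≤ c.gammaP * S.gp w} = ENNReal.ofReal (Real.exp (-c.gpMin)) := by
  have h := S.measure_gp_mem (T := Prod.fst ⁻¹' Ici c.gpMin)
    (measurable_fst measurableSet_Ici)
  have e : {w | c.thetaP ≤ c.gammaP * S.gp w} =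
      {w | (S.gp w, S.rest w) ∈ Prod.fst ⁻¹' Ici c.gpMin} := by
    ext w
    simp [LinkParams.gpMin, div_le_iff₀ c.gammaP_pos, mul_comm]
  rw [e, h]
  have e2 : ∀ w, {t | (t, S.rest w) ∈ Prod.fst ⁻¹' Ici c.gpMin} = Ici c.gpMin := fun w => rfl
  simp_rw [e2]
  rw [gammaMean_zero_Ici c.gpMin_pos, lintegral_const, measure_univ, mul_one]

/-- The endpoints may depend on all randomness except `h_p`. This covers conditions on the
feedforward signal, which become such intervals after multiplication by `λ g_x δ`. -/
lemma measure_margin_mem_Icc {a b : EuclideanSpace ℂ (Fin (k + 2)) ×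
    EuclideanSpace ℂ (Fin (k + 2)) × ℝ → ℝ} (ha : Measurable a) (hb : Measurable b)
    (ha0 : ∀ r, 0 ≤ a r) {E : Set (EuclideanSpace ℂ (Fin (k + 2)) ×
    EuclideanSpace ℂ (Fin (k + 2)) × ℝ)} (hE : MeasurableSet E) :
    μ {w | S.rest w ∈ E ∧ a (S.rest w) ≤ S.margin w ∧ S.margin w ≤ b (S.rest w)} =
      ∫⁻ w in S.rest ⁻¹' E, ENNReal.ofReal (Real.exp (-c.gpMin) *
        (Real.exp (-(c.marginRate * a (S.rest w))) -
          Real.exp (-(c.marginRate * b (S.rest w))))) ∂μ := by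
  have hκ := c.marginRate_pos
  have hT := c.gpMin_pos
  have h := S.measure_gp_mem (T := (Prod.snd ⁻¹' E) ∩
    ({p | c.gpMin + c.marginRate * a p.2 ≤ p.1} ∩ {p | p.1 ≤ c.gpMin + c.marginRate * b p.2}))
    ((measurable_snd hE).inter ((measurableSet_le (by fun_prop) (by fun_prop)).inter
      (measurableSet_le (by fun_prop) (by fun_prop))))
  have e : {w | S.rest w ∈ E ∧ a (S.rest w) ≤ S.margin w ∧ S.margin w ≤ b (S.rest w)} =
      {w | (S.gp w, S.rest w) ∈ (Prod.snd ⁻¹' E) ∩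
        ({p | c.gpMin + c.marginRate * a p.2 ≤ p.1} ∩
          {p | p.1 ≤ c.gpMin + c.marginRate * b p.2})} := by
    ext w
    simp [S.gp_eq, hκ]
  rw [e, h, ← lintegral_indicator (hE.preimage S.measurable_rest)]
  refine lintegral_congr fun w => ?_
  by_cases hw : S.rest w ∈ E
  · have e2 : {t | (t, S.rest w) ∈ (Prod.snd ⁻¹' E) ∩
        ({p | c.gpMin + c.marginRate * a p.2 ≤ p.1} ∩
          {p | p.1 ≤ c.gpMin + c.marginRate * b p.2})} =
        Icc (c.gpMin + c.marginRate * a (S.rest w)) (c.gpMin + c.marginRate * b (S.rest w)) := by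
      ext t
      simp [hw]
    have ha1 := ha0 (S.rest w)
    rw [e2, gammaMean_zero_Icc (by positivity), indicator_of_mem (show w ∈ S.rest ⁻¹' E from hw),
      neg_add, neg_add, Real.exp_add, Real.exp_add, mul_sub]
  · have e2 : {t | (t, S.rest w) ∈ (Prod.snd ⁻¹' E) ∩
        ({p | c.gpMin + c.marginRate * a p.2 ≤ p.1} ∩
          {p | p.1 ≤ c.gpMin + c.marginRate * b p.2})} = ∅ := by
      ext t
      simp [hw]
    rw [e2, indicator_of_notMem (show w ∉ S.rest ⁻¹' E from hw)]
    simp [gammaMean]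

lemma measure_margin_mem_Ioc {a b : EuclideanSpace ℂ (Fin (k + 2)) ×
    EuclideanSpace ℂ (Fin (k + 2)) × ℝ → ℝ} (ha : Measurable a) (hb : Measurable b)
    (ha0 : ∀ᵐ w ∂μ, 0 ≤ a (S.rest w)) :
    μ {w | a (S.rest w) < S.margin w ∧ S.margin w ≤ b (S.rest w)} =
      ∫⁻ w, ENNReal.ofReal (Real.exp (-c.gpMin) *
        (Real.exp (-(c.marginRate * a (S.rest w))) -
          Real.exp (-(c.marginRate * b (S.rest w))))) ∂μ := by
  have hκ := c.marginRate_pos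
  have hT := c.gpMin_pos
  have h := S.measure_gp_mem (T :=
    {p | c.gpMin + c.marginRate * a p.2 < p.1} ∩ {p | p.1 ≤ c.gpMin + c.marginRate * b p.2})
    ((measurableSet_lt (by fun_prop) (by fun_prop)).inter
      (measurableSet_le (by fun_prop) (by fun_prop)))
  have e : {w | a (S.rest w) < S.margin w ∧ S.margin w ≤ b (S.rest w)} =
      {w | (S.gp w, S.rest w) ∈ {p | c.gpMin + c.marginRate * a p.2 < p.1} ∩
          {p | p.1 ≤ c.gpMin + c.marginRate * b p.2}} := by
    ext w
    simp [S.gp_eq, hκ]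
  rw [e, h]
  refine lintegral_congr_ae ?_
  filter_upwards [ha0] with w ha1
  have e2 : {t | (t, S.rest w) ∈ {p | c.gpMin + c.marginRate * a p.2 < p.1} ∩
        {p | p.1 ≤ c.gpMin + c.marginRate * b p.2}} =
      Ioc (c.gpMin + c.marginRate * a (S.rest w)) (c.gpMin + c.marginRate * b (S.rest w)) := by
    ext t
    simp
  rw [e2, gammaMean_zero_Ioc (by positivity), neg_add, neg_add, Real.exp_add, Real.exp_add,
    mul_sub]

/-- The outage probability caused by the unquantized feedforward signal. -/
lemma measure_outage_etaFF_le {x : ℝ} (hx : 0 < x) {y : ℝ} (hy : 0 ≤ y) :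
    μ {w | x < S.projPower w ∧ 0 ≤ S.margin w ∧
        S.margin w ≤ y * (c.pathGain * S.gx w * S.delta w) / S.projPower w} ≤
      ENNReal.ofReal (Real.exp (-c.gpMin) * (c.marginRate * y * c.pathGain * cdiBound k B *
        (upperGamma k x / k.factorial))) := by
  have hκ := c.marginRate_pos
  have hD := cdiBound_pos k B
  have hl : (0 : ℝ) < c.pathGain := by exact_mod_cast c.pathGain_pos
  have m1 := S.measurable_projPowerFun
  have m2 := S.measurable_gxFun
  have m3 := S.measurable_deltaFun
  have hE : MeasurableSet (S.projPowerFun ⁻¹' Ioi x) := m1 measurableSet_Ioi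
  have h := S.measure_margin_mem_Icc (a := fun _ => 0)
    (b := fun r => y * (c.pathGain * S.gxFun r * S.deltaFun r) / S.projPowerFun r)
    measurable_const (by fun_prop) (fun _ => le_rfl) hE
  refine h.trans_le ?_
  have e : Real.exp (-c.gpMin) * (c.marginRate * y * c.pathGain * cdiBound k B *
        (upperGamma k x / k.factorial)) = cdiBound k B *
        (Real.exp (-c.gpMin) * c.marginRate * y * c.pathGain *
        (upperGamma k x / k.factorial)) := by ring
  -- The factor `1 / projPower` goes into the weight, so only the conditional mean of `g_x δ` is
  -- needed.
  rw [e, ENNReal.ofReal_mul hD.le, ← gammaMean_inv_tail k hx (by positivity),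
    ← S.lintegral_gx_delta_eq (Measurable.indicator (by fun_prop) measurableSet_Ioi),
    ← lintegral_indicator (hE.preimage S.measurable_rest)]
  refine lintegral_mono fun w => ?_
  by_cases hw : S.rest w ∈ S.projPowerFun ⁻¹' Ioi x
  · have hw' : S.projPower w ∈ Ioi x := hw
    have hp : 0 < S.projPower w := hx.trans hw'
    have hg := S.gx_nonneg w
    have hd := S.delta_nonneg w
    rw [indicator_of_mem (show w ∈ S.rest ⁻¹' (S.projPowerFun ⁻¹' Ioi x) from hw), indicator_of_mem hw',
      ← ENNReal.ofReal_mul (by positivity)]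
    refine ENNReal.ofReal_le_ofReal ?_
    rw [← S.gx_eq, ← S.delta_eq, ← S.projPower_eq]
    have h0 : 0 ≤ c.marginRate * (y * (c.pathGain * S.gx w * S.delta w) / S.projPower w) := by
      positivity
    have h1 := exp_neg_sub_exp_neg_le le_rfl h0
    rw [mul_zero]
    calc _ ≤ Real.exp (-c.gpMin) *
        (c.marginRate * (y * (c.pathGain * S.gx w * S.delta w) / S.projPower w) - 0) := by gcongr
      _ = _ := by ring
  · rw [indicator_of_notMem (show w ∉ S.rest ⁻¹' (S.projPowerFun ⁻¹' Ioi x) from hw)]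
    exact zero_le

/-- The probability that the feedforward signal falls into a cell. -/
lemma measure_etaFF_mem_cell_le {I : Set ℝ} (hI : MeasurableSet I) {a b : ℝ} (ha : 0 ≤ a)
    (hab : a ≤ b) :
    μ {w | S.projPower w ∈ I ∧ 0 ≤ S.margin w ∧ a < S.etaFF w ∧ S.etaFF w ≤ b} ≤
      ENNReal.ofReal (Real.exp (-c.gpMin) * (c.marginRate * c.pathGain * (b - a) * cdiBound k B)) *
        μ {w | S.projPower w ∈ I} := by
  have hκ := c.marginRate_pos
  have hD := cdiBound_pos k B
  have hl : (0 : ℝ) < c.pathGain := by exact_mod_cast c.pathGain_pos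
  have hba : 0 ≤ b - a := by linarith
  have m1 := S.measurable_projPowerFun
  have m2 := S.measurable_gxFun
  have m3 := S.measurable_deltaFun
  have hE : MeasurableSet (S.projPowerFun ⁻¹' I) := m1 hI
  have h := S.measure_margin_mem_Icc (a := fun r => a * (c.pathGain * S.gxFun r * S.deltaFun r))
    (b := fun r => b * (c.pathGain * S.gxFun r * S.deltaFun r))
    (by fun_prop) (by fun_prop) (fun r => by
      have := S.gxFun_nonneg r
      have := S.deltaFun_nonneg r
      positivity) hE
  have hsub : {w | S.projPower w ∈ I ∧ 0 ≤ S.margin w ∧ a < S.etaFF w ∧ S.etaFF w ≤ b} ⊆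
      {w | S.rest w ∈ S.projPowerFun ⁻¹' I ∧
        a * (c.pathGain * S.gxFun (S.rest w) * S.deltaFun (S.rest w)) ≤ S.margin w ∧
        S.margin w ≤ b * (c.pathGain * S.gxFun (S.rest w) * S.deltaFun (S.rest w))} := by
    rintro w ⟨h1, h2, h3, h4⟩
    refine ⟨h1, ?_⟩
    rw [etaFF, if_pos h2] at h3 h4
    rw [← S.gx_eq, ← S.delta_eq]
    -- A vanishing denominator would make `etaFF` equal to `0`, against `0 ≤ a < etaFF`.
    have hpos : 0 < c.pathGain * S.gx w * S.delta w := by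
      refine lt_of_le_of_ne (mul_nonneg (mul_nonneg hl.le (S.gx_nonneg w)) (S.delta_nonneg w)) ?_
      intro h0
      rw [← h0, div_zero] at h3
      linarith
    exact ⟨((lt_div_iff₀ hpos).1 h3).le, (div_le_iff₀ hpos).1 h4⟩
  refine (measure_mono hsub).trans (h.trans_le ?_)
  have hφ : Measurable (I.indicator fun _ => (1 : ENNReal)) := measurable_const.indicator hI
  have e1 : μ {w | S.projPower w ∈ I} = gammaMean k (I.indicator fun _ => 1) := by
    rw [← S.lintegral_projPower hφ]
    exact (lintegral_indicator_one (hI.preimage S.measurable_projPower)).symm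
  have e : Real.exp (-c.gpMin) * (c.marginRate * c.pathGain * (b - a) * cdiBound k B) =
      (Real.exp (-c.gpMin) * (c.marginRate * c.pathGain * (b - a))) * cdiBound k B := by ring
  rw [e, ENNReal.ofReal_mul (by positivity), mul_assoc, e1, ← S.lintegral_gx_delta_eq hφ,
    ← lintegral_const_mul' _ _ ENNReal.ofReal_ne_top,
    ← lintegral_indicator (hE.preimage S.measurable_rest)]
  refine lintegral_mono fun w => ?_
  by_cases hw : S.rest w ∈ S.projPowerFun ⁻¹' I
  · have hw' : S.projPower w ∈ I := hw
    have hg := S.gx_nonneg w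
    have hd := S.delta_nonneg w
    rw [indicator_of_mem (show w ∈ S.rest ⁻¹' (S.projPowerFun ⁻¹' I) from hw), indicator_of_mem hw',
      mul_one, ← ENNReal.ofReal_mul (by positivity)]
    refine ENNReal.ofReal_le_ofReal ?_
    rw [← S.gx_eq, ← S.delta_eq]
    have h0 : c.marginRate * (a * (c.pathGain * S.gx w * S.delta w)) ≤
        c.marginRate * (b * (c.pathGain * S.gx w * S.delta w)) := by gcongr
    have h1 := exp_neg_sub_exp_neg_le (by positivity) h0
    calc _ ≤ Real.exp (-c.gpMin) * (c.marginRate * (b * (c.pathGain * S.gx w * S.delta w)) -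
          c.marginRate * (a * (c.pathGain * S.gx w * S.delta w))) := by gcongr
      _ = _ := by ring
  · rw [indicator_of_notMem (show w ∉ S.rest ⁻¹' (S.projPowerFun ⁻¹' I) from hw)]
    exact zero_le

/-- The length of a cell of `η` in terms of its probability, up to a quadratic error. -/
lemma length_le_measure_eta_mem_cell {a b : ℝ} (ha : 0 ≤ a) (hab : a ≤ b) :
    ENNReal.ofReal (Real.exp (-c.gpMin) * (c.marginRate * c.pathGain * (b - a) *
        ((k + 1) * cdiBound k B))) ≤
      μ {w | 0 ≤ S.margin w ∧ a < S.eta w ∧ S.eta w ≤ b} +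
        ENNReal.ofReal (Real.exp (-c.gpMin) * ((c.marginRate * c.pathGain * b) ^ 2 *
          ((k + 2) * (k + 3) * cdiBound k B ^ 2))) := by
  have hκ := c.marginRate_pos
  have hD := cdiBound_pos k B
  have hl : (0 : ℝ) < c.pathGain := by exact_mod_cast c.pathGain_pos
  have hba : 0 ≤ b - a := by linarith
  have m2 := S.measurable_gxFun
  have m3 := S.measurable_epsilonFun
  have h := S.measure_margin_mem_Ioc
    (a := fun r => a * (c.pathGain * S.gxFun r * S.epsilonFun r))
    (b := fun r => b * (c.pathGain * S.gxFun r * S.epsilonFun r))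
    (by fun_prop) (by fun_prop) (by
      filter_upwards [S.ae_hx_ne_zero] with w hw
      have h1 := S.gx_nonneg w
      have h2 := S.epsilon_nonneg hw
      rw [← S.gx_eq, ← S.epsilon_eq_fun]
      positivity)
  have hsub : {w | a * (c.pathGain * S.gxFun (S.rest w) * S.epsilonFun (S.rest w)) < S.margin w ∧
      S.margin w ≤ b * (c.pathGain * S.gxFun (S.rest w) * S.epsilonFun (S.rest w))} ≤ᵐ[μ]
      {w | 0 ≤ S.margin w ∧ a < S.eta w ∧ S.eta w ≤ b} := by
    filter_upwards [S.ae_hx_ne_zero, S.ae_epsilon_ne_zero] with w hw hw' hmem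
    obtain ⟨h1, h2⟩ := hmem
    rw [← S.gx_eq, ← S.epsilon_eq_fun] at h1 h2
    have hpos : 0 < c.pathGain * S.gx w * S.epsilon w :=
      mul_pos (mul_pos hl (S.gx_pos hw)) (lt_of_le_of_ne (S.epsilon_nonneg hw) (Ne.symm hw'))
    have h0 : 0 ≤ S.margin w := le_trans (by positivity) h1.le
    refine ⟨h0, ?_⟩
    rw [eta, if_pos h0]
    exact ⟨(lt_div_iff₀ hpos).2 h1, (div_le_iff₀ hpos).2 h2⟩
  refine le_trans ?_ (add_le_add (measure_mono_ae hsub) le_rfl)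
  rw [h, show Real.exp (-c.gpMin) * (c.marginRate * c.pathGain * (b - a) *
        ((k + 1) * cdiBound k B)) = Real.exp (-c.gpMin) * (c.marginRate * c.pathGain * (b - a)) *
        ((k + 1) * cdiBound k B) by ring, ENNReal.ofReal_mul (by positivity),
    ← S.lintegral_gx_epsilon_eq, ← lintegral_const_mul' _ _ ENNReal.ofReal_ne_top,
    show Real.exp (-c.gpMin) * ((c.marginRate * c.pathGain * b) ^ 2 *
        ((k + 2) * (k + 3) * cdiBound k B ^ 2)) = Real.exp (-c.gpMin) *
        (c.marginRate * c.pathGain * b) ^ 2 * ((k + 2) * (k + 3) * cdiBound k B ^ 2) by ring,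
    ENNReal.ofReal_mul (p := Real.exp (-c.gpMin) * (c.marginRate * c.pathGain * b) ^ 2)
      (by positivity)]
  refine le_trans ?_ (add_le_add le_rfl (mul_le_mul_right (S.lintegral_gx_epsilon_sq_le) _))
  rw [← lintegral_const_mul' _ _ ENNReal.ofReal_ne_top, ← lintegral_add_right]
  · refine lintegral_mono_ae ?_
    filter_upwards [S.ae_hx_ne_zero] with w hw
    have hg := S.gx_nonneg w
    have hd := S.epsilon_nonneg hw
    rw [← S.gx_eq, ← S.epsilon_eq_fun, ← ENNReal.ofReal_mul (by positivity),
      ← ENNReal.ofReal_mul (by positivity)]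
    have h0 : c.marginRate * (a * (c.pathGain * S.gx w * S.epsilon w)) ≤
        c.marginRate * (b * (c.pathGain * S.gx w * S.epsilon w)) := by gcongr
    -- The quadratic error involves only the upper endpoint `b`, which capping at `P_max` will bound
    -- uniformly over the cells.
    have h1 := sub_le_exp_neg_sub_exp_neg (by positivity) h0
    have h2 := Real.exp_le_exp.2 (neg_le_neg h0)
    rw [← ENNReal.ofReal_add (mul_nonneg (Real.exp_pos _).le (sub_nonneg.2 h2)) (by positivity)]
    refine ENNReal.ofReal_le_ofReal ?_
    calc _ = Real.exp (-c.gpMin) * (c.marginRate * (b * (c.pathGain * S.gx w * S.epsilon w)) -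
          c.marginRate * (a * (c.pathGain * S.gx w * S.epsilon w))) := by ring
      _ ≤ Real.exp (-c.gpMin) * _ := mul_le_mul_of_nonneg_left h1 (Real.exp_pos _).le
      _ = _ := by ring
  · have h1 := S.measurable_gx
    have h2 := S.measurable_epsilon
    fun_prop

end CognitiveLink

/-! ### Codebook rounding and the optimal beamformer -/

lemma CognitiveLink.exists_codebookFloor_eq (A : ℕ) {p : ℕ → ℝ} (h0 : p 0 = 0) {x : ℝ}
    (hx : 0 ≤ x) :
    ∃ n, n < 2 ^ A ∧ CognitiveLink.codebookFloor A p x = p n ∧ p n ≤ x ∧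
      ∀ m, m < 2 ^ A → p m ≤ x → p m ≤ p n := by
  set s := {q : ℝ | (∃ n, n < 2 ^ A ∧ p n = q) ∧ q ≤ x} with hs
  have hfin : s.Finite := by
    refine ((Finset.range (2 ^ A)).image p).finite_toSet.subset ?_
    rintro q ⟨⟨n, hn, rfl⟩, -⟩
    simpa using ⟨n, hn, rfl⟩
  have hne : s.Nonempty := ⟨p 0, ⟨0, by positivity, rfl⟩, by rwa [h0]⟩
  obtain ⟨⟨n, hn, hpn⟩, hle⟩ := hne.csSup_mem hfin
  refine ⟨n, hn, hpn.symm, hpn ▸ hle, fun m hm hmx => ?_⟩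
  rw [hpn]
  exact le_csSup hfin.bddAbove ⟨⟨m, hm, rfl⟩, hmx⟩

namespace CognitiveLink

section

variable {k : ℕ} {c : LinkParams} {B : ℕ} {Ω : Type*} [MeasurableSpace Ω] {μ : Measure Ω}
  (S : CognitiveLink (k + 2) c B μ)

lemma etaFF_nonneg {w : Ω} (hw : 0 ≤ S.margin w) : 0 ≤ S.etaFF w := by
  rw [etaFF, if_pos hw]
  have := S.gx_nonneg w
  have := S.delta_nonneg w
  positivity

lemma etaFFQuant_nonneg (A : ℕ) {p : ℕ → ℝ} (h0 : p 0 = 0) (w : Ω) :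
    0 ≤ S.etaFFQuant A p w := by
  unfold etaFFQuant
  split_ifs with h
  · have hx := S.etaFF_nonneg h.1
    obtain ⟨n, -, h1, -, h2⟩ := exists_codebookFloor_eq A h0 hx
    rw [h1, ← h0]
    exact h2 0 (by positivity) (h0 ▸ hx)
  · exact c.powerMax_pos.le

/-- The receive SNR under the OCB beamformer is at least that of the normalized projection. -/
lemma le_snrS {P : Ω → ℝ} {f : Ω → EuclideanSpace ℂ (Fin (k + 2))} (hf : S.IsOCBBeamformer P f)
    {w : Ω} (hw : S.hx w ≠ 0) (hP : 0 ≤ P w) (hG : 0 < S.projPower w) :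
    P w * S.projPower w / c.noise ≤ S.snrS f w := by
  have hq := S.norm_sxHat hw
  have hs : S.hs w ≠ 0 := by
    intro h
    simp [projPower, perp, h] at hG
  have hss : S.ss w = ((‖S.hs w‖⁻¹ : ℝ) : ℂ) • S.hs w := by simp [ss, channelShape]
  set u := perp (S.sxHat w) (S.ss w) with hu
  have hu1 : ‖u‖ ^ 2 * S.gs w = S.projPower w := by
    have : ‖S.hs w‖ ≠ 0 := norm_ne_zero_iff.2 hs
    rw [hu, hss, perp_smul, norm_smul, projPower, gs, Complex.norm_real, norm_inv, norm_norm]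
    field_simp
  have hu0 : u ≠ 0 := by
    intro h
    rw [h] at hu1
    simp at hu1
    exact hG.ne hu1
  have hun : ‖u‖ ≠ 0 := norm_ne_zero_iff.2 hu0
  -- Competitor for the maximization: full power along the projection of `s_s`. Only this lower
  -- bound on the SNR is needed, not the exact maximizer.
  set v := ((√(P w) : ℝ) : ℂ) • channelShape u with hv
  have hvmem : v ∈ S.feasible (P w) w := by
    constructor
    · rw [hv, channelShape, inner_smul_left, inner_smul_left,
        inner_eq_zero_symm.1 (inner_perp_right hq _)]
      simp
    · rw [hv, norm_smul, norm_channelShape hu0, Complex.norm_real, mul_one, Real.norm_eq_abs,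
        sq_abs, Real.sq_sqrt hP]
  have hinner : ‖inner ℂ v (S.ss w)‖ ^ 2 = P w * ‖u‖ ^ 2 := by
    have h1 : inner ℂ u (S.ss w) = inner ℂ u u := by
      conv_rhs => rw [hu, perp, inner_sub_right, inner_smul_right,
        ← perp, inner_eq_zero_symm.1 (inner_perp_right hq _), mul_zero, sub_zero]
    rw [hv, channelShape, inner_smul_left, inner_smul_left, h1, inner_self_eq_norm_sq_to_K]
    simp only [Complex.conj_ofReal, map_inv₀, norm_mul, norm_inv, norm_pow, Complex.norm_real,
      Complex.coe_algebraMap, mul_pow, Real.norm_eq_abs, sq_abs, Real.sq_sqrt hP,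
      abs_norm]
    field_simp
  have hmax : ‖inner ℂ v (S.ss w)‖ ^ 2 ≤ ‖inner ℂ (f w) (S.ss w)‖ ^ 2 := (hf w).2 hvmem
  rw [hinner] at hmax
  have hgs : 0 ≤ S.gs w / c.noise := div_nonneg (by unfold gs; positivity) c.noise_pos.le
  rw [snrS, ← hu1]
  calc _ = S.gs w / c.noise * (P w * ‖u‖ ^ 2) := by ring
    _ ≤ _ := mul_le_mul_of_nonneg_left hmax hgs

end

end CognitiveLink

/-! ### Quantization cells and the union bound -/

/-- The upper end of the part below `Pmax` of the `n`-th quantization cell. -/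
noncomputable def cellEnd (A : ℕ) (p : ℕ → ℝ) (Pmax : ℝ) (n : ℕ) : ℝ :=
  if n + 1 < 2 ^ A then min (p (n + 1)) Pmax else Pmax

/-- The values `g > x` for which `y / g` lies in the `n`-th quantization cell. -/
def cellPowers (A : ℕ) (p : ℕ → ℝ) (x y : ℝ) (n : ℕ) : Set ℝ :=
  {g | x < g ∧ p n ≤ y / g ∧ (n + 1 < 2 ^ A → y / g < p (n + 1))}

lemma measurableSet_cellPowers (A : ℕ) (p : ℕ → ℝ) (x y : ℝ) (n : ℕ) :
    MeasurableSet (cellPowers A p x y n) := by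
  have hm : Measurable fun g : ℝ => y / g := by fun_prop
  by_cases h : n + 1 < 2 ^ A
  · simp only [cellPowers, h, true_imp_iff]
    exact (measurableSet_lt measurable_const measurable_id).inter
      ((measurableSet_le measurable_const hm).inter (measurableSet_lt hm measurable_const))
  · simp only [cellPowers, h, false_imp_iff, and_true]
    exact (measurableSet_lt measurable_const measurable_id).inter
      (measurableSet_le measurable_const hm)

lemma codebook_mono {A : ℕ} {p : ℕ → ℝ} (h : ∀ n, n + 1 < 2 ^ A → p n < p (n + 1)) {m n : ℕ}
    (hmn : m ≤ n) (hn : n < 2 ^ A) : p m ≤ p n := by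
  induction n, hmn using Nat.le_induction with
  | base => exact le_rfl
  | succ n _ ih => exact (ih (by omega)).trans (h n hn).le

lemma disjoint_cellPowers {A : ℕ} {p : ℕ → ℝ} (h : ∀ n, n + 1 < 2 ^ A → p n < p (n + 1))
    (x y : ℝ) {m n : ℕ} (hmn : m < n) (hn : n < 2 ^ A) :
    Disjoint (cellPowers A p x y m) (cellPowers A p x y n) := by
  rw [Set.disjoint_left]
  rintro g ⟨-, -, h1⟩ ⟨-, h2, -⟩
  have h3 := h1 (by omega)
  have h4 : p (m + 1) ≤ p n := codebook_mono h hmn hn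
  linarith

namespace CognitiveLink

variable {k : ℕ} {c : LinkParams} {B : ℕ} {Ω : Type*} [MeasurableSpace Ω] {μ : Measure Ω}
  (S : CognitiveLink (k + 2) c B μ)

/-- An outage has one of three causes: a weak secondary channel, a small feedforward signal, or
the loss by its quantization. -/
lemma outage_cases {A : ℕ} {p : ℕ → ℝ} (h0 : p 0 = 0)
    {f : Ω → EuclideanSpace ℂ (Fin (k + 2))} (hf : S.IsOCBBeamformer (S.etaFFQuant A p) f)
    {w : Ω} (hw : S.hx w ≠ 0) (hd : S.delta w ≠ 0) (hout : S.snrS f w ≤ c.thetaS) :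
    S.projPower w ≤ c.thetaS / c.gammaMax ∨
      (c.thetaS / c.gammaMax < S.projPower w ∧ 0 ≤ S.margin w ∧
        S.margin w ≤ c.thetaS * c.noise * (c.pathGain * S.gx w * S.delta w) / S.projPower w) ∨
      ∃ n < 2 ^ A, S.projPower w ∈
          cellPowers A p (c.thetaS / c.gammaMax) (c.thetaS * c.noise) n ∧
        0 ≤ S.margin w ∧ p n < S.etaFF w ∧ S.etaFF w ≤ cellEnd A p c.powerMax n := by
  by_contra! hcon
  obtain ⟨hG, h2, h3⟩ := hcon
  have hs := c.noise_pos
  have hθ := c.thetaS_pos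
  have hPm := c.powerMax_pos
  have hl : (0 : ℝ) < c.pathGain := by exact_mod_cast c.pathGain_pos
  have hG0 : 0 < S.projPower w := (div_pos hθ c.gammaMax_pos).trans hG
  have hle := (S.le_snrS hf hw (S.etaFFQuant_nonneg A h0 w) hG0).trans hout
  rw [div_le_iff₀ hs, ← le_div_iff₀ hG0] at hle
  -- The assumption `G > x` says that full power avoids outage, which rules out the full-power
  -- branch of `etaFFQuant`.
  have hGx : c.thetaS * c.noise / S.projPower w < c.powerMax := by
    rw [div_lt_iff₀ hG0]
    rw [LinkParams.gammaMax, div_div_eq_mul_div, div_lt_iff₀ hPm] at hG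
    linarith
  unfold etaFFQuant at hle
  split_ifs at hle with hc
  · obtain ⟨hm, hlt⟩ := hc
    have h2 := h2 hG hm
    have hpos : 0 < c.pathGain * S.gx w * S.delta w :=
      mul_pos (mul_pos hl (S.gx_pos hw)) (lt_of_le_of_ne (S.delta_nonneg w) (Ne.symm hd))
    have hτ : c.thetaS * c.noise / S.projPower w < S.etaFF w := by
      rw [etaFF, if_pos hm, lt_div_iff₀ hpos]
      rwa [mul_div_right_comm] at h2
    have hτ0 : 0 ≤ c.thetaS * c.noise / S.projPower w := by positivity
    obtain ⟨n, hn, h4, h5, h6⟩ := exists_codebookFloor_eq A h0 (S.etaFF_nonneg hm)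
    rw [h4] at hle
    -- The floor of `etaFF` is at most the threshold, so no codebook point separates the threshold
    -- from `etaFF`.
    have hnext : ∀ i, i < 2 ^ A → c.thetaS * c.noise / S.projPower w < p i → S.etaFF w < p i := by
      intro i hi hlt
      by_contra hc
      exact absurd (h6 i hi (not_lt.1 hc)) (by linarith)
    -- The cell of the threshold. If none existed, climbing from `p 0 = 0` would put every point
    -- below the threshold; the last index, having no successor, then contradicts this.
    obtain ⟨m, hm1, hm2, hm3⟩ : ∃ m, m < 2 ^ A ∧ p m ≤ c.thetaS * c.noise / S.projPower w ∧
        (m + 1 < 2 ^ A → c.thetaS * c.noise / S.projPower w < p (m + 1)) := by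
      by_contra hcon
      push Not at hcon
      have hall : ∀ m, m < 2 ^ A → p m ≤ c.thetaS * c.noise / S.projPower w := by
        intro m
        induction m with
        | zero => intro _; rwa [h0]
        | succ m ih => intro hm; exact (hcon m (by omega) (ih (by omega))).2
      have hN : 0 < 2 ^ A := by positivity
      have := (hcon (2 ^ A - 1) (by omega) (hall _ (by omega))).1
      omega
    have hend := h3 m hm1 ⟨hG, hm2, hm3⟩ hm (hm2.trans_lt hτ)
    unfold cellEnd at hend
    split_ifs at hend with hm4
    · exact absurd (le_min (hnext _ hm4 (hm3 hm4)).le hlt.le) (not_le.2 hend)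
    · exact absurd hlt.le (not_le.2 hend)
  · linarith

lemma measurable_gp : Measurable S.gp := by
  have := S.measurable_hp
  unfold gp
  fun_prop

/-- Disjointness of the cells keeps the sum of `2^A` losses, each of order `2^(-A)`, from growing to
order one. -/
lemma sum_measure_cellPowers_le {A : ℕ} {p : ℕ → ℝ}
    (h : ∀ n, n + 1 < 2 ^ A → p n < p (n + 1)) (x y : ℝ) :
    ∑ n ∈ Finset.range (2 ^ A), μ {w | S.projPower w ∈ cellPowers A p x y n} ≤
      μ {w | x < S.projPower w} := by
  rw [← measure_biUnion_finset]
  · refine measure_mono ?_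
    simp only [iUnion_subset_iff]
    exact fun n _ w hw => hw.1
  · intro m hm n hn hmn
    have hm' : m < 2 ^ A := by simpa using hm
    have hn' : n < 2 ^ A := by simpa using hn
    rcases lt_or_gt_of_ne hmn with hlt | hlt
    · exact (disjoint_cellPowers h x y hlt hn').preimage S.projPower
    · exact ((disjoint_cellPowers h x y hlt hm').preimage S.projPower).symm
  · exact fun n _ => (measurableSet_cellPowers A p x y n).preimage S.measurable_projPower

variable [IsProbabilityMeasure μ]

lemma measure_inter_of_cond {t : Set Ω} {x : ℝ}
    (h : (cond μ {w | c.thetaP ≤ c.gammaP * S.gp w}).real t = x) :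
    μ ({w | c.thetaP ≤ c.gammaP * S.gp w} ∩ t) = ENNReal.ofReal (Real.exp (-c.gpMin) * x) := by
  have hm := S.measurable_gp
  have hs : MeasurableSet {w | c.thetaP ≤ c.gammaP * S.gp w} :=
    measurableSet_le (by fun_prop) (by fun_prop)
  have h1 := cond_mul_eq_inter hs t μ
  rw [S.measure_margin_nonneg] at h1
  rw [← h1, ← h, mul_comm, ENNReal.ofReal_mul (by positivity), ofReal_measureReal]

lemma measure_eta_mem_cell_le {A : ℕ} {p : ℕ → ℝ} (hp : S.IsIPCCodebook A p) {n : ℕ}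
    (hn : n < 2 ^ A) :
    μ {w | 0 ≤ S.margin w ∧ p n < S.eta w ∧ S.eta w ≤ cellEnd A p c.powerMax n} ≤
      ENNReal.ofReal (Real.exp (-c.gpMin) * (1 / 2 ^ A)) := by
  by_cases h : n + 1 < 2 ^ A
  · rw [← S.measure_inter_of_cond (hp.cell n h)]
    refine measure_mono ?_
    rintro w ⟨h1, h2, h3⟩
    refine ⟨(S.margin_nonneg_iff w).1 h1, h2, ?_⟩
    rw [cellEnd, if_pos h] at h3
    exact h3.trans (min_le_left _ _)
  · obtain rfl : n = 2 ^ A - 1 := by omega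
    rw [← S.measure_inter_of_cond hp.last]
    refine measure_mono ?_
    rintro w ⟨h1, h2, -⟩
    exact ⟨(S.margin_nonneg_iff w).1 h1, h2⟩

/-- The codebook is designed for `η`, not for the feedforward signal; the cell length links the two.
It is bounded through the `η`-probability and inserted in the feedforward bound, where the ratio of
the means of `g_x δ` and `g_x ε` yields `1/(k+1)`. -/
lemma measure_quantization_loss_le {A : ℕ} {p : ℕ → ℝ} (hp : S.IsIPCCodebook A p) {n : ℕ}
    (hn : n < 2 ^ A) {I : Set ℝ} (hI : MeasurableSet I) :
    μ {w | S.projPower w ∈ I ∧ 0 ≤ S.margin w ∧ p n < S.etaFF w ∧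
        S.etaFF w ≤ cellEnd A p c.powerMax n} ≤
      ENNReal.ofReal (Real.exp (-c.gpMin) / (k + 1) * (1 / 2 ^ A +
        (c.marginRate * c.pathGain * c.powerMax) ^ 2 * ((k + 2) * (k + 3)) * cdiBound k B ^ 2)) *
        μ {w | S.projPower w ∈ I} := by
  have hκ := c.marginRate_pos
  have hD := cdiBound_pos k B
  have hl : (0 : ℝ) < c.pathGain := by exact_mod_cast c.pathGain_pos
  have hPm := c.powerMax_pos
  have hpn : 0 ≤ p n := hp.zero ▸ codebook_mono hp.lt_succ (Nat.zero_le n) hn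
  rcases le_or_gt (p n) (cellEnd A p c.powerMax n) with hle | hlt
  · refine (S.measure_etaFF_mem_cell_le hI hpn hle).trans
      (mul_le_mul_left (ENNReal.ofReal_le_ofReal ?_) _)
    have h1 := (S.length_le_measure_eta_mem_cell hpn hle).trans
      (add_le_add (S.measure_eta_mem_cell_le hp hn) le_rfl)
    rw [← ENNReal.ofReal_add (by positivity) (by positivity),
      ENNReal.ofReal_le_ofReal_iff (by positivity)] at h1
    have hb : cellEnd A p c.powerMax n ≤ c.powerMax := by
      unfold cellEnd
      split_ifs
      exacts [min_le_right _ _, le_rfl]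
    have hb0 := hpn.trans hle
    have h2 : (c.marginRate * c.pathGain * cellEnd A p c.powerMax n) ^ 2 *
        ((k + 2) * (k + 3) * cdiBound k B ^ 2) ≤ (c.marginRate * c.pathGain * c.powerMax) ^ 2 *
        ((k + 2) * (k + 3) * cdiBound k B ^ 2) := by gcongr
    have h3 := mul_le_mul_of_nonneg_left h2 (Real.exp_pos (-c.gpMin)).le
    rw [div_mul_eq_mul_div, le_div_iff₀ (by positivity)]
    linarith
  -- A cell that starts above `P_max` is empty after capping.
  · have : {w | S.projPower w ∈ I ∧ 0 ≤ S.margin w ∧ p n < S.etaFF w ∧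
        S.etaFF w ≤ cellEnd A p c.powerMax n} = ∅ := by
      ext w
      simp only [mem_ofPred_eq, mem_empty_iff_false, iff_false]
      rintro ⟨-, -, h1, h2⟩
      linarith
    rw [this, measure_empty]
    exact zero_le

lemma measure_lt_projPower {x : ℝ} (hx : 0 < x) :
    μ {w | x < S.projPower w} = ENNReal.ofReal (upperGamma (k + 1) x / k.factorial) := by
  rw [← gammaMean_tail k hx, ← S.lintegral_projPower (measurable_const.indicator measurableSet_Ioi)]
  exact (lintegral_indicator_one (measurableSet_Ioi.preimage S.measurable_projPower)).symm

lemma outageS_le {A : ℕ} {p : ℕ → ℝ} (hp : S.IsIPCCodebook A p)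
    {f : Ω → EuclideanSpace ℂ (Fin (k + 2))} (hf : S.IsOCBBeamformer (S.etaFFQuant A p) f) :
    S.outageS f ≤ 1 - upperGamma (k + 1) (c.thetaS / c.gammaMax) / k.factorial +
      Real.exp (-c.gpMin) * (c.marginRate * (c.thetaS * c.noise) * c.pathGain * cdiBound k B *
        (upperGamma k (c.thetaS / c.gammaMax) / k.factorial)) +
      Real.exp (-c.gpMin) / (k + 1) * (1 / 2 ^ A +
        (c.marginRate * c.pathGain * c.powerMax) ^ 2 * ((k + 2) * (k + 3)) * cdiBound k B ^ 2) *
        (upperGamma (k + 1) (c.thetaS / c.gammaMax) / k.factorial) := by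
  have hκ := c.marginRate_pos
  have hD := cdiBound_pos k B
  have hs := c.noise_pos
  have hθ := c.thetaS_pos
  have hx : 0 < c.thetaS / c.gammaMax := div_pos hθ c.gammaMax_pos
  have hg1 := upperGamma_nonneg (k + 1) hx.le
  have hg2 := upperGamma_nonneg k hx.le
  set x := c.thetaS / c.gammaMax with hxdef
  set q := Real.exp (-c.gpMin) / (k + 1) * (1 / 2 ^ A +
        (c.marginRate * c.pathGain * c.powerMax) ^ 2 * ((k + 2) * (k + 3)) * cdiBound k B ^ 2)
    with hq
  have hq0 : 0 ≤ q := by positivity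
  set E : ℕ → Set Ω := fun n => {w | S.projPower w ∈ cellPowers A p x (c.thetaS * c.noise) n ∧
    0 ≤ S.margin w ∧ p n < S.etaFF w ∧ S.etaFF w ≤ cellEnd A p c.powerMax n}
  have h1 : μ {w | S.projPower w ≤ x} =
      ENNReal.ofReal (1 - upperGamma (k + 1) x / k.factorial) := by
    have hm : MeasurableSet {w | x < S.projPower w} :=
      measurableSet_Ioi.preimage S.measurable_projPower
    have e : {w | S.projPower w ≤ x} = {w | x < S.projPower w}ᶜ := by
      ext w
      simp
    have hr : μ.real {w | x < S.projPower w} = upperGamma (k + 1) x / k.factorial := by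
      rw [measureReal_def, S.measure_lt_projPower hx, ENNReal.toReal_ofReal (by positivity)]
    rw [e, ← hr, ← probReal_compl_eq_one_sub hm, ofReal_measureReal]
  -- Needed for nonnegativity of the first term when the `ENNReal` bounds are added and turned into
  -- a real inequality.
  have hle1 : upperGamma (k + 1) x / k.factorial ≤ 1 := by
    rw [← ENNReal.ofReal_le_one, ← S.measure_lt_projPower hx]
    exact prob_le_one
  have h3 : μ (⋃ n ∈ Finset.range (2 ^ A), E n) ≤
      ENNReal.ofReal (q * (upperGamma (k + 1) x / k.factorial)) := by
    refine (measure_biUnion_finset_le _ _).trans ?_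
    refine (Finset.sum_le_sum fun n hn => S.measure_quantization_loss_le hp
      (Finset.mem_range.1 hn) (measurableSet_cellPowers A p x (c.thetaS * c.noise) n)).trans ?_
    rw [← Finset.mul_sum, ENNReal.ofReal_mul hq0, ← S.measure_lt_projPower hx]
    gcongr
    exact S.sum_measure_cellPowers_le hp.lt_succ _ _
  have hsub : {w | S.snrS f w ≤ c.thetaS} ≤ᵐ[μ] (({w | S.projPower w ≤ x} ∪
      {w | x < S.projPower w ∧ 0 ≤ S.margin w ∧ S.margin w ≤
        c.thetaS * c.noise * (c.pathGain * S.gx w * S.delta w) / S.projPower w}) ∪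
      ⋃ n ∈ Finset.range (2 ^ A), E n : Set Ω) := by
    filter_upwards [S.ae_hx_ne_zero, S.ae_delta_ne_zero] with w hw hd hout
    rcases S.outage_cases hp.zero hf hw hd hout with h | h | ⟨n, hn, h⟩
    · exact Or.inl (Or.inl h)
    · exact Or.inl (Or.inr h)
    · exact Or.inr (mem_iUnion₂.2 ⟨n, Finset.mem_range.2 hn, h⟩)
  have htot := ((measure_mono_ae hsub).trans (measure_union_le _ _)).trans
    (add_le_add ((measure_union_le _ _).trans
      (add_le_add h1.le (S.measure_outage_etaFF_le hx (by positivity)))) h3)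
  rw [← ENNReal.ofReal_add (by linarith) (by positivity),
    ← ENNReal.ofReal_add (add_nonneg (by linarith) (by positivity)) (by positivity)] at htot
  exact ENNReal.toReal_le_of_le_ofReal
    (add_nonneg (add_nonneg (by linarith) (by positivity)) (by positivity)) htot

end CognitiveLink

theorem mainTheorem5 (L : ℕ) (hL : 2 ≤ L) (c : LinkParams) :
    ∃ C : ℝ, ∀ (A B : ℕ) (Ω : Type*) [MeasurableSpace Ω] (μ : Measure Ω)
      [IsProbabilityMeasure μ] (S : CognitiveLink L c B μ) (p : ℕ → ℝ)
      (_ : S.IsIPCCodebook A p) (f : Ω → EuclideanSpace ℂ (Fin L))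
      (_ : S.IsOCBBeamformer (S.etaFFQuant A p) f),
      S.outageS f ≤
        1 - upperGamma ((L : ℝ) - 1) (c.thetaS / c.gammaMax) / Real.Gamma ((L : ℝ) - 1)
          + (c.phi L * (2 : ℝ) ^ (-((B : ℝ) / ((L : ℝ) - 1)))
              + c.alpha L * (2 : ℝ) ^ (-(A : ℝ))) / ((L : ℝ) - 1)
          + C * (2 : ℝ) ^ (-(2 * (B : ℝ) / ((L : ℝ) - 1))) := by
  obtain ⟨k, rfl⟩ : ∃ k, L = k + 2 := ⟨L - 2, by omega⟩
  -- This is the coefficient of `cdiBound k B ^ 2`, from the second-order error in comparing cell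
  -- length with `η`-probability; `(k + 2) * (k + 3)` is the second moment of `g_x`.
  refine ⟨c.alpha (k + 2) * ((c.marginRate * c.pathGain * c.powerMax) ^ 2 *
    ((k + 2) * (k + 3))) / (k + 1), ?_⟩
  intro A B Ω _ μ _ S p hp f hf
  refine (S.outageS_le hp hf).trans (le_of_eq ?_)
  have e1 : ((k + 2 : ℕ) : ℝ) - 1 = k + 1 := by push_cast; ring
  have e2 : ((k + 2 : ℕ) : ℝ) - 2 = k := by push_cast; ring
  have e3 : (2 : ℝ) ^ (-(2 * (B : ℝ) / (k + 1))) = cdiBound k B ^ 2 := by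
    rw [cdiBound, ← Real.rpow_natCast, ← Real.rpow_mul (by norm_num)]
    congr 1
    push_cast
    ring
  have e4 : (2 : ℝ) ^ (-(A : ℝ)) = 1 / 2 ^ A := by
    rw [Real.rpow_neg (by norm_num), Real.rpow_natCast, one_div]
  have hs := c.noise_pos
  have hg := c.gammaP_pos
  rw [LinkParams.phi, LinkParams.alpha, e1, e2, e3, e4, Real.Gamma_nat_eq_factorial, ← cdiBound,
    LinkParams.marginRate, LinkParams.gpMin]
  field_simp
  ring
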